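/- Let $m\ge 2$, let $\beta\neq0$ be real, and let $f_{i,i+1}, f_{i+1,i}$ ($i=1,\dots,m-1$) be nonzero real constants such that $f_{i,i+1}$ and $f_{i+1,i}$ have the same sign for every $i$ (in particular, they may be arbitrary positive numbers); put $f_{1,0}=f_{m,m+1}=0$. Consider the multi-layer quasi-geostrophic system for the functions $\psi^1,\dots,\psi^m$ of $(t,x,y)$, \[ q^i_t+\psi^i_xq^i_y-\psi^i_yq^i_x=0,\qquad q^i:=\psi^i_{xx}+\psi^i_{yy}+f_{i,i-1}(\psi^{i-1}-\psi^i)-f_{i,i+1}(\psi^i-\psi^{i+1})+\beta y,\qquad i=1,\dots,m. \] A vector field $Q=\tau\partial_t+\xi^x\partial_x+\xi^y\partial_y+\sum_i\eta^i\partial_{\psi^i}$, whose components are smooth functions of $(t,x,y,\psi^1,\dots,\psi^m)$ on an open convex set $U\subseteq\mathbb R^{3+m}$ (for example $U=\mathbb R^{3+m}$), is called a Lie symmetry vector field of the system if its third prolongation annihilates the left-hand side of each equation at all points of the third-order jet space over $U$ that satisfy the system. The set $\mathfrak g$ of all Lie symmetry vector fields on $U$ (the maximal Lie invariance algebra of the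 system) is closed under the Lie bracket of vector fields, and it is the linear span over $\mathbb R$ of the vector fields \[ \partial_t,\quad \partial_y,\quad \mathcal P^x(\chi)=\chi(t)\partial_x-y\chi_t(t)\big(\partial_{\psi^1}+\dots+\partial_{\psi^m}\big),\quad \partial_{\psi^1},\ \dots,\ \partial_{\psi^m},\quad \mathcal Z(\kappa)=\kappa(t)\big(\partial_{\psi^1}+\dots+\partial_{\psi^m}\big) \] (restricted to $U$), where $\chi$ and $\kappa$ run through the smooth functions of $t$ on the interval of the values that $t$ takes on $U$. In particular, $\mathfrak g$ does not depend on the constants $f_{i,i\pm1}$ and $\beta$. -/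

import Mathlib

open scoped ContDiff

namespace MultiLayerQG

noncomputable section

/-- The space with coordinates `(t, x, y, ψ¹, …, ψᵐ)`.
The independent variables `t, x, y` are numbered `0, 1, 2`. -/
abbrev PointSpace (m : ℕ) : Type := (Fin 3 → ℝ) × (Fin m → ℝ)

/-- The infinite jet space. A jet `z` consists of a point `z.1 = (t, x, y)` and of the values
`z.2 i J = ψⁱ_J` of all derivatives of the dependent variables, where the multi-index
`J : Fin 3 → ℕ` counts the differentiations in `t`, `x` and `y`. -/
abbrev JetSpace (m : ℕ) : Type := (Fin 3 → ℝ) × (Fin m → (Fin 3 → ℕ) → ℝ)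

/-- A vector field `τ ∂_t + ξˣ ∂_x + ξʸ ∂_y + ∑ ηⁱ ∂_{ψⁱ}`: the first component of its value is
`(τ, ξˣ, ξʸ)`, the second one is `(η¹, …, ηᵐ)`. -/
abbrev VField (m : ℕ) : Type := PointSpace m → PointSpace m

variable {m : ℕ}

/-- The point `(t, x, y, ψ)` over which a jet lies. -/
def toPoint (z : JetSpace m) : PointSpace m := (z.1, fun i => z.2 i 0)

/-- The multi-index of a single differentiation in the `k`th independent variable. -/
def idx (k : Fin 3) : Fin 3 → ℕ := Pi.single k 1

/-- The total derivative `D_k = ∂_k + ∑ ψⁱ_{J + k} ∂_{ψⁱ_J}`, as the derivative along the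
vector with the components `1` at `∂_k` and `ψⁱ_{J + k}` at `∂_{ψⁱ_J}`. -/
def totalDeriv (k : Fin 3) (F : JetSpace m → ℝ) : JetSpace m → ℝ := fun z =>
  lineDeriv ℝ F z (Pi.single k 1, fun i J => z.2 i (J + idx k))

/-- The iterated total derivative `D_J`. -/
def totalDerivMulti (J : Fin 3 → ℕ) (F : JetSpace m → ℝ) : JetSpace m → ℝ :=
  (totalDeriv 0)^[J 0] ((totalDeriv 1)^[J 1] ((totalDeriv 2)^[J 2] F))

/-- The characteristic `ηⁱ - τ ψⁱ_t - ξˣ ψⁱ_x - ξʸ ψⁱ_y` of a vector field. -/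
def characteristic (Q : VField m) (i : Fin m) : JetSpace m → ℝ := fun z =>
  (Q (toPoint z)).2 i - ∑ k, (Q (toPoint z)).1 k * z.2 i (idx k)

/-- The prolongation of a vector field to the jet space. Its component at `∂_{ψⁱ_J}` is
`D_J (ηⁱ - τ ψⁱ_t - ξˣ ψⁱ_x - ξʸ ψⁱ_y) + τ ψⁱ_{J + t} + ξˣ ψⁱ_{J + x} + ξʸ ψⁱ_{J + y}`. -/
def prolongation (Q : VField m) : JetSpace m → JetSpace m := fun z =>
  ((Q (toPoint z)).1, fun i J =>
    totalDerivMulti J (characteristic Q i) z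
      + ∑ k, (Q (toPoint z)).1 k * z.2 i (J + idx k))

/-- The potential vorticity
`qⁱ = ψⁱ_xx + ψⁱ_yy + f_{i,i-1} (ψⁱ⁻¹ - ψⁱ) - f_{i,i+1} (ψⁱ - ψⁱ⁺¹) + β y`. The sum over the
layers `j` adjacent to `i` omits the terms with `f_{1,0}` and `f_{m,m+1}`, which are zero. -/
def vorticity (f : Fin m → Fin m → ℝ) (β : ℝ) (i : Fin m) : JetSpace m → ℝ := fun z =>
  z.2 i (idx 1 + idx 1) + z.2 i (idx 2 + idx 2)
    + (∑ j : Fin m, if i.val + 1 = j.val ∨ j.val + 1 = i.val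
        then f i j * (z.2 j 0 - z.2 i 0) else 0)
    + β * z.1 2

/-- The left-hand side `qⁱ_t + ψⁱ_x qⁱ_y - ψⁱ_y qⁱ_x` of the `i`th equation of the system. -/
def qgEquation (f : Fin m → Fin m → ℝ) (β : ℝ) (i : Fin m) : JetSpace m → ℝ := fun z =>
  totalDeriv 0 (vorticity f β i) z
    + z.2 i (idx 1) * totalDeriv 2 (vorticity f β i) z
    - z.2 i (idx 2) * totalDeriv 1 (vorticity f β i) z

/-- `Q` is a Lie symmetry vector field, on the open set `U`, of the system with the parameters
`f` and `β`: its components are smooth, and the prolongation of `Q` annihilates the left-hand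
sides of the equations at all jets over `U` that satisfy the system. (The left-hand sides have
order three, so only the third prolongation of `Q` is involved.) -/
def IsLieSymmetryOn (f : Fin m → Fin m → ℝ) (β : ℝ) (U : Set (PointSpace m))
    (Q : VField m) : Prop :=
  ContDiffOn ℝ ∞ Q U ∧
    ∀ z : JetSpace m, toPoint z ∈ U → (∀ i, qgEquation f β i z = 0) →
      ∀ i, lineDeriv ℝ (qgEquation f β i) z (prolongation Q z) = 0

/-- The maximal Lie invariance algebra on `U`: all Lie symmetry vector fields. The values of a
vector field outside `U` play no role. -/
def maxLieInvarianceAlgebra (f : Fin m → Fin m → ℝ) (β : ℝ) (U : Set (PointSpace m)) :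
    Set (VField m) :=
  {Q | IsLieSymmetryOn f β U Q}

/-- `∂_t` -/
def fieldPt : VField m := fun _ => (Pi.single 0 1, 0)

/-- `∂_y` -/
def fieldPy : VField m := fun _ => (Pi.single 2 1, 0)

/-- `χ(t) ∂_x - y χ_t(t) (∂_{ψ¹} + … + ∂_{ψᵐ})` -/
def fieldPx (χ : ℝ → ℝ) : VField m := fun p =>
  (Pi.single 1 (χ (p.1 0)), fun _ => -(p.1 2 * deriv χ (p.1 0)))

/-- `∂_{ψⁱ}` -/
def fieldJ (i : Fin m) : VField m := fun _ => (0, Pi.single i 1)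

/-- `κ(t) (∂_{ψ¹} + … + ∂_{ψᵐ})` -/
def fieldZ (κ : ℝ → ℝ) : VField m := fun p => (0, fun _ => κ (p.1 0))

/-- The values that the variable `t` takes on `U`. -/
def timeRange (U : Set (PointSpace m)) : Set ℝ := (fun p => p.1 0) '' U

/-- The spanning vector fields, with parameter functions `χ` and `κ` of `t` that are smooth where
they are needed, that is, on the set of the values of `t` on `U`. -/
def spanningFields (U : Set (PointSpace m)) : Set (VField m) :=
  {fieldPt, fieldPy}
    ∪ {Q | ∃ χ : ℝ → ℝ, ContDiffOn ℝ ∞ χ (timeRange U) ∧ Q = fieldPx χ}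
    ∪ Set.range fieldJ
    ∪ {Q | ∃ κ : ℝ → ℝ, ContDiffOn ℝ ∞ κ (timeRange U) ∧ Q = fieldZ κ}

end

end MultiLayerQG

/-!
The components of the prolonged field in the criterion of infinitesimal invariance are evaluated
at jets with arbitrary derivatives of orders one and three and with vanishing derivatives of order
two. Since each equation can be solved for `ψⁱ_txx`, the part of the criterion that is linear in
the third-order derivatives vanishes at all solutions of the linear homogeneous equations. This
makes `ξ` independent of `ψ` and `τ` a function of `t`, and gives the Cauchy-Riemann equations for
`(ξˣ, ξʸ)` as well as `ηⁱ_x = ξʸ_t`, `ηⁱ_y = -ξˣ_t` and `ηⁱ_{ψⁱ} = 2 ξˣ_x - τ_t`.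

In the remaining part of the criterion, a value of `ψʲ_t` in a single layer `j` adjacent to `i`
enters with the coefficient `2 f_{i,j} ξˣ_x`, so `ξˣ_x = 0`, and `ω = ξʸ_x` depends on `t` only.
With the same first-order derivatives `b` in all layers, the criterion becomes
`2 ω_tt + ∑ⱼ f_{i,j} (ηʲ_t - ηⁱ_t) + β (ξʸ_t + b₁ τ_t - b₂ ω) = 0`, where `j` runs through the
layers adjacent to `i`. As `β ≠ 0`, it follows that `τ_t = ω = 0`. The matrix of the coupling
between adjacent layers has a positive left null vector because `f_{i,i+1} f_{i+1,i} > 0`, hence a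
constant vector in its range is zero, and its kernel consists of the constant vectors: `ξʸ_t = 0`,
and all `ηⁱ_t` are equal. These equations are then integrated on the convex set `U`.
-/

namespace MultiLayerQG

noncomputable section

section DirectionalDerivative

variable {E F : Type*} [NormedAddCommGroup E] [NormedSpace ℝ E] [NormedAddCommGroup F]
  [NormedSpace ℝ F] {U : Set E} {g h : E → F} {p : E}

theorem differentiableAt_of_contDiffOn (hU : IsOpen U) (hg : ContDiffOn ℝ ∞ g U) (hp : p ∈ U) :
    DifferentiableAt ℝ g p :=
  (hg.contDiffAt (hU.mem_nhds hp)).differentiableAt (by simp)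

theorem contDiffOn_fderiv (hU : IsOpen U) (hg : ContDiffOn ℝ ∞ g U) :
    ContDiffOn ℝ ∞ (fderiv ℝ g) U :=
  hg.fderiv_of_isOpen hU (by simp)

/-- The derivative of `g` along the constant vector field `v`. In contrast to `lineDeriv` it is
linear in `v` at every point, also where `g` is not differentiable. -/
def dirDeriv (v : E) (g : E → F) : E → F := fun p => fderiv ℝ g p v

theorem dirDeriv_of_hasFDerivAt {g' : E →L[ℝ] F} (hg : HasFDerivAt g g' p) (v : E) :
    dirDeriv v g p = g' v := by
  rw [dirDeriv, hg.fderiv]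

theorem dirDeriv_add_dir (u v : E) (g : E → F) :
    dirDeriv (u + v) g = dirDeriv u g + dirDeriv v g :=
  funext fun _ => map_add _ _ _

theorem dirDeriv_smul_dir (r : ℝ) (v : E) (g : E → F) : dirDeriv (r • v) g = r • dirDeriv v g :=
  funext fun _ => map_smul _ _ _

theorem eqOn_dirDeriv (hU : IsOpen U) (hgh : Set.EqOn g h U) (v : E) :
    Set.EqOn (dirDeriv v g) (dirDeriv v h) U := fun p hp => by
  simp only [dirDeriv, (hgh.eventuallyEq_of_mem (hU.mem_nhds hp)).fderiv_eq]

theorem eqOn_dirDeriv_zero (hU : IsOpen U) (hg : Set.EqOn g 0 U) (v : E) :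
    Set.EqOn (dirDeriv v g) 0 U :=
  (eqOn_dirDeriv hU hg v).trans fun p _ => by simp [dirDeriv, Pi.zero_def]

theorem contDiffOn_dirDeriv (hU : IsOpen U) (hg : ContDiffOn ℝ ∞ g U) (v : E) :
    ContDiffOn ℝ ∞ (dirDeriv v g) U :=
  (contDiffOn_fderiv hU hg).clm_apply contDiffOn_const

theorem dirDeriv_dirDeriv (hU : IsOpen U) (hg : ContDiffOn ℝ ∞ g U) (u v : E) (hp : p ∈ U) :
    dirDeriv u (dirDeriv v g) p = fderiv ℝ (fderiv ℝ g) p u v := by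
  have hd := (differentiableAt_of_contDiffOn hU (contDiffOn_fderiv hU hg) hp).hasFDerivAt
  change fderiv ℝ (fun q => fderiv ℝ g q v) p u = _
  simp [(hd.clm_apply (hasFDerivAt_const v p)).fderiv]

theorem dirDeriv_dirDeriv_dirDeriv (hU : IsOpen U) (hg : ContDiffOn ℝ ∞ g U) (u v w : E)
    (hp : p ∈ U) : dirDeriv u (dirDeriv v (dirDeriv w g)) p
      = fderiv ℝ (fderiv ℝ (fderiv ℝ g)) p u v w := by
  have hd := (differentiableAt_of_contDiffOn hU
    (contDiffOn_fderiv hU (contDiffOn_fderiv hU hg)) hp).hasFDerivAt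
  rw [eqOn_dirDeriv hU (fun q hq => dirDeriv_dirDeriv hU hg v w hq) u hp]
  change fderiv ℝ (fun q => fderiv ℝ (fderiv ℝ g) q v w) p u = _
  simp [((hd.clm_apply (hasFDerivAt_const v p)).clm_apply (hasFDerivAt_const w p)).fderiv]

theorem dirDeriv_comm (hU : IsOpen U) (hg : ContDiffOn ℝ ∞ g U) (u v : E) :
    Set.EqOn (dirDeriv u (dirDeriv v g)) (dirDeriv v (dirDeriv u g)) U := fun p hp => by
  have hsymm : IsSymmSndFDerivAt ℝ g p :=
    (hg.contDiffAt (hU.mem_nhds hp)).isSymmSndFDerivAt (by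
      rw [minSmoothness_of_isRCLikeNormedField]; exact ENat.LEInfty.out)
  rw [dirDeriv_dirDeriv hU hg _ _ hp, dirDeriv_dirDeriv hU hg _ _ hp, hsymm.eq]

theorem dirDeriv_neg (v : E) (g : E → F) : dirDeriv v (-g) = -dirDeriv v g := by
  funext p
  simp [dirDeriv, fderiv_neg]

theorem eqOn_dirDeriv_dirDeriv_zero (hU : IsOpen U) (hg : ContDiffOn ℝ ∞ g U) {v : E}
    (hv : Set.EqOn (dirDeriv v g) 0 U) (u : E) : Set.EqOn (dirDeriv v (dirDeriv u g)) 0 U :=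
  (dirDeriv_comm hU hg v u).trans (eqOn_dirDeriv_zero hU hv u)

theorem dirDeriv_clm_comp {G : Type*} [NormedAddCommGroup G] [NormedSpace ℝ G] (hU : IsOpen U)
    (hg : ContDiffOn ℝ ∞ g U) (ℓ : F →L[ℝ] G) (v : E) :
    Set.EqOn (dirDeriv v (ℓ ∘ g)) (ℓ ∘ dirDeriv v g) U := fun p hp => by
  simp [dirDeriv, (ℓ.hasFDerivAt.comp p
    (differentiableAt_of_contDiffOn hU hg hp).hasFDerivAt).fderiv]

theorem exists_eqOn_comp_of_fderiv_ker {g : E → ℝ} (hU : IsOpen U) (hUc : Convex ℝ U)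
    (hg : ContDiffOn ℝ ∞ g U) (L : E →L[ℝ] ℝ) {e : E} (hLe : L e = 1)
    (hker : ∀ q ∈ U, ∀ v, L v = 0 → fderiv ℝ g q v = 0) :
    ∃ χ : ℝ → ℝ, ContDiffOn ℝ ∞ χ (L '' U) ∧ Set.EqOn g (χ ∘ L) U := by
  have hfibre : ∀ q ∈ U, ∀ r ∈ U, L q = L r → g q = g r := fun q hq r hr hqr => by
    obtain ⟨w, hw, hgw⟩ := domain_mvt
      (fun w hw => (differentiableAt_of_contDiffOn hU hg hw).hasFDerivAt.hasFDerivWithinAt)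
      hUc hr hq
    rw [hker w (hUc.segment_subset hr hq hw) _ (by simp [hqr])] at hgw
    exact sub_eq_zero.1 hgw
  have hχ : Set.EqOn g ((g ∘ Function.invFunOn L U) ∘ L) U := fun q hq =>
    hfibre q hq _ (Function.invFunOn_apply_mem hq) (Function.invFunOn_apply_eq hq).symm
  refine ⟨g ∘ Function.invFunOn L U, ?_, hχ⟩
  rintro _ ⟨q, hq, rfl⟩
  let line : ℝ → E := fun t => q + (t - L q) • e
  have hline : ContDiff ℝ ∞ line := by fun_prop
  have hLline : ∀ t, L (line t) = t := fun t => by simp [line, hLe]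
  have hq' : line (L q) = q := by simp [line]
  have hg' : ContDiffAt ℝ ∞ g (line (L q)) := by
    rw [hq']; exact hg.contDiffAt (hU.mem_nhds hq)
  have hmem : ∀ᶠ t in nhds (L q), line t ∈ U :=
    hline.continuous.continuousAt.eventually_mem (by rw [hq']; exact hU.mem_nhds hq)
  refine ((hg'.comp _ hline.contDiffAt).congr_of_eventuallyEq ?_).contDiffWithinAt
  filter_upwards [hmem] with t ht
  simpa [hLline] using (hχ ht).symm

end DirectionalDerivative

variable {m : ℕ}

section Coupling

variable {f : Fin m → Fin m → ℝ} {i j : Fin m} {u v : Fin m → ℝ} {r : ℝ}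

/-- The operator `u ↦ f_{i,i-1} (uⁱ⁻¹ - uⁱ) - f_{i,i+1} (uⁱ - uⁱ⁺¹)` that couples the layers, with
the terms of the missing layers `0` and `m + 1` omitted as in `vorticity`. -/
def coupling (f : Fin m → Fin m → ℝ) (i : Fin m) : (Fin m → ℝ) →ₗ[ℝ] ℝ where
  toFun u := ∑ j : Fin m, if i.val + 1 = j.val ∨ j.val + 1 = i.val
    then f i j * (u j - u i) else 0
  map_add' u v := by
    rw [← Finset.sum_add_distrib]
    refine Finset.sum_congr rfl fun j _ => ?_
    simp only [Pi.add_apply]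
    split_ifs <;> ring
  map_smul' r u := by
    rw [Finset.smul_sum]
    refine Finset.sum_congr rfl fun j _ => ?_
    simp only [Pi.smul_apply, smul_eq_mul, RingHom.id_apply]
    split_ifs <;> ring

theorem coupling_apply (f : Fin m → Fin m → ℝ) (i : Fin m) (u : Fin m → ℝ) :
    coupling f i u = ∑ j : Fin m, if i.val + 1 = j.val ∨ j.val + 1 = i.val
      then f i j * (u j - u i) else 0 := rfl

theorem coupling_congr (h : ∀ j, u j - u i = v j - v i) : coupling f i u = coupling f i v := by
  simp only [coupling_apply, h]

theorem coupling_const (f : Fin m → Fin m → ℝ) (i : Fin m) (r : ℝ) :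
    coupling f i (fun _ => r) = 0 := by
  simp [coupling_apply]

theorem coupling_single (h : i.val + 1 = j.val ∨ j.val + 1 = i.val) :
    coupling f i (Pi.single j 1) = f i j := by
  have hij : i ≠ j := by rintro rfl; omega
  rw [coupling_apply, Finset.sum_eq_single j (fun l _ hl => by simp [hl, hij]) (by simp)]
  simp [h, hij]

/-- The term of `coupling` that comes from the layer `i + 1`. -/
def couplingNext (f : Fin m → Fin m → ℝ) (i : Fin m) (u : Fin m → ℝ) : ℝ :=
  ∑ j : Fin m, if i.val + 1 = j.val then f i j * (u j - u i) else 0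

theorem couplingNext_eq (h : i.val + 1 = j.val) : couplingNext f i u = f i j * (u j - u i) := by
  have hnext : ∀ l : Fin m, i.val + 1 = l.val ↔ l = j := fun l => by rw [Fin.ext_iff]; omega
  simp [couplingNext, hnext]

theorem couplingNext_last (h : i.val + 1 = m) : couplingNext f i u = 0 :=
  Finset.sum_eq_zero fun j _ => if_neg (by omega)

theorem coupling_first (h : i.val = 0) : coupling f i u = couplingNext f i u := by
  simp [coupling_apply, couplingNext, h]

theorem coupling_succ (h : i.val + 1 = j.val) :
    coupling f j u = couplingNext f j u + f j i * (u i - u j) := by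
  have hprev : ∀ l : Fin m, l.val + 1 = j.val ↔ l = i := fun l => by rw [Fin.ext_iff]; omega
  have hi : f j i * (u i - u j) = ∑ l : Fin m, if l.val + 1 = j.val
      then f j l * (u l - u j) else 0 := by simp [hprev]
  rw [hi, couplingNext, coupling_apply, ← Finset.sum_add_distrib]
  refine Finset.sum_congr rfl fun l _ => ?_
  by_cases hnext : j.val + 1 = l.val
  · simp [hnext, show l.val + 1 ≠ j.val by omega]
  · simp [hnext]

theorem exists_couplingNext_eq_mul
    (hf : ∀ i j : Fin m, i.val + 1 = j.val → 0 < f i j * f j i)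
    (h : ∀ i, coupling f i u = r) (i : Fin m) : ∃ s > 0, couplingNext f i u = s * r := by
  obtain ⟨n, hn⟩ := i
  induction n with
  | zero => exact ⟨1, one_pos, by rw [← coupling_first rfl, h, one_mul]⟩
  | succ n ih =>
    obtain ⟨s, hs, hnext⟩ := ih (by omega)
    let i : Fin m := ⟨n, by omega⟩
    let j : Fin m := ⟨n + 1, hn⟩
    have hij : i.val + 1 = j.val := rfl
    have hfij : f i j ≠ 0 := left_ne_zero_of_mul (hf i j hij).ne'
    have hratio : 0 < f j i / f i j := by
      rw [← mul_div_mul_left _ _ hfij]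
      exact div_pos (hf i j hij) (mul_self_pos.2 hfij)
    refine ⟨1 + f j i / f i j * s, by positivity, ?_⟩
    have hj := h j
    rw [coupling_succ hij] at hj
    rw [couplingNext_eq hij] at hnext
    have hback : f j i * (u i - u j) = -(f j i / f i j * (s * r)) := by
      rw [← hnext]; field_simp; ring
    linear_combination hj - hback

theorem eq_zero_and_eq_of_coupling_eq_const (hm : 0 < m)
    (hf : ∀ i j : Fin m, i.val + 1 = j.val → 0 < f i j * f j i)
    (h : ∀ i, coupling f i u = r) : r = 0 ∧ ∀ i j, u i = u j := by
  have hr : r = 0 := by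
    obtain ⟨s, hs, hlast⟩ := exists_couplingNext_eq_mul hf h ⟨m - 1, by omega⟩
    rw [couplingNext_last (Nat.sub_add_cancel hm)] at hlast
    exact (mul_eq_zero.1 hlast.symm).resolve_left hs.ne'
  have hfirst : ∀ i, u i = u ⟨0, hm⟩ := by
    rintro ⟨n, hn⟩
    induction n with
    | zero => rfl
    | succ n ih =>
      obtain ⟨s, -, hnext⟩ := exists_couplingNext_eq_mul hf h ⟨n, by omega⟩
      rw [couplingNext_eq (j := ⟨n + 1, hn⟩) rfl, hr, mul_zero] at hnext
      have hne := left_ne_zero_of_mul (hf ⟨n, by omega⟩ ⟨n + 1, hn⟩ rfl).ne'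
      exact (sub_eq_zero.1 ((mul_eq_zero.1 hnext).resolve_left hne)).trans (ih (by omega))
  exact ⟨hr, fun i j => (hfirst i).trans (hfirst j).symm⟩

end Coupling

section LineDerivative

variable {E F : Type*} [AddCommGroup E] [Module ℝ E] [NormedAddCommGroup F] [NormedSpace ℝ F]

theorem hasLineDerivAt_of_isLinearMap {ℓ : E → F} (hℓ : IsLinearMap ℝ ℓ) (z v : E) :
    HasLineDerivAt ℝ ℓ (ℓ v) z v := by
  simpa [HasLineDerivAt, hℓ.map_add, hℓ.map_smul]
    using ((hasDerivAt_id (0 : ℝ)).smul_const (ℓ v)).const_add (ℓ z)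

theorem hasLineDerivAt_mul {A : Type*} [NormedRing A] [NormedAlgebra ℝ A] {G H : E → A}
    {G' H' : A} {z v : E} (hG : HasLineDerivAt ℝ G G' z v) (hH : HasLineDerivAt ℝ H H' z v) :
    HasLineDerivAt ℝ (fun z => G z * H z) (G' * H z + G z * H') z v := by
  simpa [HasLineDerivAt] using HasDerivAt.fun_mul hG hH

end LineDerivative

section TotalDerivative

variable {U : Set (PointSpace m)} {F G : JetSpace m → ℝ} {z : JetSpace m}

/-- The vector field `∂_k + ∑ ψⁱ_{J + k} ∂_{ψⁱ_J}` on the jet space, along which `totalDeriv k`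
differentiates. -/
def jetShift (k : Fin 3) (z : JetSpace m) : JetSpace m :=
  (Pi.single k 1, fun i J => z.2 i (J + idx k))

/-- The projection of `jetShift k` to the space of points. -/
def tangentVec (k : Fin 3) (z : JetSpace m) : PointSpace m :=
  (Pi.single k 1, fun i => z.2 i (idx k))

/-- The vertical vector `∑ ψⁱ_J ∂_{ψⁱ}`: the iterated derivatives of `tangentVec` along the fields
`jetShift` have this form. -/
def fibreVec (J : Fin 3 → ℕ) (z : JetSpace m) : PointSpace m := (0, fun i => z.2 i J)

theorem toPoint_jetShift (k : Fin 3) (z : JetSpace m) :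
    toPoint (jetShift k z) = tangentVec k z := by
  simp [toPoint, jetShift, tangentVec]

theorem totalDeriv_eq_of_hasLineDerivAt {k : Fin 3} {F' : ℝ}
    (h : HasLineDerivAt ℝ F F' z (jetShift k z)) : totalDeriv k F z = F' :=
  h.lineDeriv

theorem hasDerivAt_toPoint_line (z v : JetSpace m) :
    HasDerivAt (fun s : ℝ => toPoint (z + s • v)) (toPoint v) 0 :=
  hasLineDerivAt_of_isLinearMap (ℓ := toPoint) ⟨fun _ _ => rfl, fun _ _ => rfl⟩ z v

theorem eqOn_totalDeriv (hU : IsOpen U) (h : Set.EqOn F G (toPoint ⁻¹' U)) (k : Fin 3) :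
    Set.EqOn (totalDeriv k F) (totalDeriv k G) (toPoint ⁻¹' U) := fun z hz => by
  have hmem : ∀ᶠ s : ℝ in nhds 0, toPoint (z + s • jetShift k z) ∈ U :=
    (hasDerivAt_toPoint_line z _).continuousAt.eventually_mem (hU.mem_nhds (by simpa using hz))
  exact Filter.EventuallyEq.deriv_eq (hmem.mono fun s hs => h hs)

theorem totalDerivMulti_idx (F : JetSpace m → ℝ) (a : Fin 3) :
    totalDerivMulti (idx a) F = totalDeriv a F := by
  fin_cases a <;> simp [totalDerivMulti, idx]

theorem totalDerivMulti_idx_add_idx_add_idx (F : JetSpace m → ℝ) {a b c : Fin 3} (hab : a ≤ b)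
    (hbc : b ≤ c) :
    totalDerivMulti (idx a + idx b + idx c) F = totalDeriv a (totalDeriv b (totalDeriv c F)) := by
  fin_cases a <;> fin_cases b <;> fin_cases c <;>
    first
    | (exfalso; revert hab hbc; decide)
    | simp [totalDerivMulti, idx]

theorem hasLineDerivAt_jetCoord (i : Fin m) (J : Fin 3 → ℕ) (z v : JetSpace m) :
    HasLineDerivAt ℝ (fun z : JetSpace m => z.2 i J) (v.2 i J) z v :=
  hasLineDerivAt_of_isLinearMap (ℓ := fun z : JetSpace m => z.2 i J)
    ⟨fun _ _ => rfl, fun _ _ => rfl⟩ z v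

theorem hasLineDerivAt_baseCoord (k : Fin 3) (z v : JetSpace m) :
    HasLineDerivAt ℝ (fun z : JetSpace m => z.1 k) (v.1 k) z v :=
  hasLineDerivAt_of_isLinearMap (ℓ := fun z : JetSpace m => z.1 k)
    ⟨fun _ _ => rfl, fun _ _ => rfl⟩ z v

theorem hasLineDerivAt_coupling (f : Fin m → Fin m → ℝ) (i : Fin m) (J : Fin 3 → ℕ)
    (z v : JetSpace m) :
    HasLineDerivAt ℝ (fun z : JetSpace m => coupling f i fun j => z.2 j J)
      (coupling f i fun j => v.2 j J) z v :=
  hasLineDerivAt_of_isLinearMap (ℓ := fun z : JetSpace m => coupling f i fun j => z.2 j J)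
    ⟨fun _ _ => map_add (coupling f i) _ _, fun _ _ => map_smul (coupling f i) _ _⟩ z v

theorem hasLineDerivAt_fibreVec (J : Fin 3 → ℕ) (a : Fin 3) (z : JetSpace m) :
    HasLineDerivAt ℝ (fibreVec J) (fibreVec (J + idx a) z) z (jetShift a z) :=
  hasLineDerivAt_of_isLinearMap (ℓ := fibreVec J)
    ⟨fun _ _ => Prod.ext (zero_add 0).symm rfl, fun _ _ => Prod.ext (smul_zero _).symm rfl⟩
    z (jetShift a z)

theorem tangentVec_eq (k : Fin 3) (z : JetSpace m) :
    tangentVec k z = (Pi.single k 1, 0) + fibreVec (idx k) z := by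
  simp [tangentVec, fibreVec]

theorem hasLineDerivAt_tangentVec (c a : Fin 3) (z : JetSpace m) :
    HasLineDerivAt ℝ (tangentVec c) (fibreVec (idx c + idx a) z) z (jetShift a z) := by
  rw [funext (tangentVec_eq c)]
  exact HasDerivAt.const_add _ (hasLineDerivAt_fibreVec (idx c) a z)

theorem hasLineDerivAt_comp_toPoint {E : Type*} [NormedAddCommGroup E] [NormedSpace ℝ E]
    {g : PointSpace m → E} (hg : DifferentiableAt ℝ g (toPoint z)) (k : Fin 3) :
    HasLineDerivAt ℝ (fun z => g (toPoint z)) (fderiv ℝ g (toPoint z) (tangentVec k z)) z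
      (jetShift k z) := by
  rw [← toPoint_jetShift]
  exact hg.hasFDerivAt.comp_hasDerivAt_of_eq 0 (hasDerivAt_toPoint_line z _) (by simp)

/-- The total derivative `D_a g` of a function `g` of `(t, x, y, ψ¹, …, ψᵐ)`. -/
def totalOne (g : PointSpace m → ℝ) (a : Fin 3) (z : JetSpace m) : ℝ :=
  fderiv ℝ g (toPoint z) (tangentVec a z)

/-- The iterated total derivative `D_b D_c g` of a function `g` of `(t, x, y, ψ¹, …, ψᵐ)`. -/
def totalTwo (g : PointSpace m → ℝ) (b c : Fin 3) (z : JetSpace m) : ℝ :=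
  fderiv ℝ (fderiv ℝ g) (toPoint z) (tangentVec b z) (tangentVec c z)
    + fderiv ℝ g (toPoint z) (fibreVec (idx c + idx b) z)

/-- The iterated total derivative `D_a D_b D_c g` of a function `g` of `(t, x, y, ψ¹, …, ψᵐ)`. -/
def totalThree (g : PointSpace m → ℝ) (a b c : Fin 3) (z : JetSpace m) : ℝ :=
  fderiv ℝ (fderiv ℝ (fderiv ℝ g)) (toPoint z) (tangentVec a z) (tangentVec b z) (tangentVec c z)
    + fderiv ℝ (fderiv ℝ g) (toPoint z) (fibreVec (idx b + idx a) z) (tangentVec c z)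
    + fderiv ℝ (fderiv ℝ g) (toPoint z) (tangentVec b z) (fibreVec (idx c + idx a) z)
    + fderiv ℝ (fderiv ℝ g) (toPoint z) (tangentVec a z) (fibreVec (idx c + idx b) z)
    + fderiv ℝ g (toPoint z) (fibreVec (idx c + idx b + idx a) z)

variable {g : PointSpace m → ℝ}

theorem hasLineDerivAt_comp_totalOne (hU : IsOpen U) (hg : ContDiffOn ℝ ∞ g U)
    (hz : toPoint z ∈ U) (a : Fin 3) :
    HasLineDerivAt ℝ (fun z => g (toPoint z)) (totalOne g a z) z (jetShift a z) :=
  hasLineDerivAt_comp_toPoint (differentiableAt_of_contDiffOn hU hg hz) a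

theorem hasLineDerivAt_totalOne (hU : IsOpen U) (hg : ContDiffOn ℝ ∞ g U)
    (hz : toPoint z ∈ U) (b c : Fin 3) :
    HasLineDerivAt ℝ (totalOne g c) (totalTwo g b c z) z (jetShift b z) := by
  have hg' := contDiffOn_fderiv hU hg
  have := HasDerivAt.clm_apply
    (hasLineDerivAt_comp_toPoint (differentiableAt_of_contDiffOn hU hg' hz) b)
    (hasLineDerivAt_tangentVec c b z)
  simpa [HasLineDerivAt, totalOne, totalTwo] using this

theorem hasLineDerivAt_totalTwo (hU : IsOpen U) (hg : ContDiffOn ℝ ∞ g U)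
    (hz : toPoint z ∈ U) (a b c : Fin 3) :
    HasLineDerivAt ℝ (totalTwo g b c) (totalThree g a b c z) z (jetShift a z) := by
  have hg' := contDiffOn_fderiv hU hg
  have h₁ := hasLineDerivAt_comp_toPoint (differentiableAt_of_contDiffOn hU hg' hz) a
  have h₂ := hasLineDerivAt_comp_toPoint
    (differentiableAt_of_contDiffOn hU (contDiffOn_fderiv hU hg') hz) a
  have := ((HasDerivAt.clm_apply h₂ (hasLineDerivAt_tangentVec b a z)).clm_apply
    (hasLineDerivAt_tangentVec c a z)).fun_add
    (HasDerivAt.clm_apply h₁ (hasLineDerivAt_fibreVec (idx c + idx b) a z))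
  simp only [zero_smul, add_zero, add_apply] at this
  simp only [HasLineDerivAt, totalTwo, totalThree]
  convert this using 1
  ring

end TotalDerivative

section Prolongation

variable {U : Set (PointSpace m)} {Q : VField m} {z : JetSpace m}

/-- The components `τ`, `ξˣ`, `ξʸ` of a vector field. -/
def horizontal (Q : VField m) (k : Fin 3) (p : PointSpace m) : ℝ := (Q p).1 k

/-- The components `ηⁱ` of a vector field. -/
def vertical (Q : VField m) (i : Fin m) (p : PointSpace m) : ℝ := (Q p).2 i

theorem contDiffOn_horizontal (hQ : ContDiffOn ℝ ∞ Q U) (k : Fin 3) :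
    ContDiffOn ℝ ∞ (horizontal Q k) U :=
  contDiffOn_pi.1 hQ.fst k

theorem contDiffOn_vertical (hQ : ContDiffOn ℝ ∞ Q U) (i : Fin m) :
    ContDiffOn ℝ ∞ (vertical Q i) U :=
  contDiffOn_pi.1 hQ.snd i

theorem characteristic_eq (Q : VField m) (i : Fin m) :
    characteristic Q i = fun z => vertical Q i (toPoint z)
      - ∑ k, horizontal Q k (toPoint z) * z.2 i (idx k) := rfl

theorem totalDeriv_characteristic (hU : IsOpen U) (hQ : ContDiffOn ℝ ∞ Q U) (hz : toPoint z ∈ U)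
    (i : Fin m) (c : Fin 3) :
    totalDeriv c (characteristic Q i) z = totalOne (vertical Q i) c z
      - ∑ k, (totalOne (horizontal Q k) c z * z.2 i (idx k)
        + horizontal Q k (toPoint z) * z.2 i (idx k + idx c)) := by
  rw [characteristic_eq]
  exact totalDeriv_eq_of_hasLineDerivAt <| HasDerivAt.fun_sub
    (hasLineDerivAt_comp_totalOne hU (contDiffOn_vertical hQ i) hz c)
    (HasDerivAt.fun_sum fun k _ => hasLineDerivAt_mul
      (hasLineDerivAt_comp_totalOne hU (contDiffOn_horizontal hQ k) hz c)
      (hasLineDerivAt_jetCoord i (idx k) z (jetShift c z)))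

theorem totalDeriv_totalDeriv_characteristic (hU : IsOpen U) (hQ : ContDiffOn ℝ ∞ Q U)
    (hz : toPoint z ∈ U) (i : Fin m) (b c : Fin 3) :
    totalDeriv b (totalDeriv c (characteristic Q i)) z = totalTwo (vertical Q i) b c z
      - ∑ k, (totalTwo (horizontal Q k) b c z * z.2 i (idx k)
        + totalOne (horizontal Q k) c z * z.2 i (idx k + idx b)
        + totalOne (horizontal Q k) b z * z.2 i (idx k + idx c)
        + horizontal Q k (toPoint z) * z.2 i (idx k + idx c + idx b)) := by
  rw [eqOn_totalDeriv hU (fun z hz => totalDeriv_characteristic hU hQ hz i c) b hz]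
  have hξ := contDiffOn_horizontal hQ
  have hcoord := fun J => hasLineDerivAt_jetCoord i J z (jetShift b z)
  have := HasDerivAt.fun_sub (hasLineDerivAt_totalOne hU (contDiffOn_vertical hQ i) hz b c)
    (HasDerivAt.fun_sum (u := Finset.univ) fun k _ => HasDerivAt.fun_add
      (hasLineDerivAt_mul (hasLineDerivAt_totalOne hU (hξ k) hz b c) (hcoord (idx k)))
      (hasLineDerivAt_mul (hasLineDerivAt_comp_totalOne hU (hξ k) hz b)
        (hcoord (idx k + idx c))))
  refine totalDeriv_eq_of_hasLineDerivAt (HasDerivAt.congr_deriv this ?_)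
  congr 1
  refine Finset.sum_congr rfl fun k _ => ?_
  simp only [jetShift]
  ring

theorem totalDeriv_totalDeriv_totalDeriv_characteristic (hU : IsOpen U)
    (hQ : ContDiffOn ℝ ∞ Q U) (hz : toPoint z ∈ U) (i : Fin m) (a b c : Fin 3) :
    totalDeriv a (totalDeriv b (totalDeriv c (characteristic Q i))) z
      = totalThree (vertical Q i) a b c z
      - ∑ k, (totalThree (horizontal Q k) a b c z * z.2 i (idx k)
        + totalTwo (horizontal Q k) b c z * z.2 i (idx k + idx a)
        + totalTwo (horizontal Q k) a c z * z.2 i (idx k + idx b)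
        + totalTwo (horizontal Q k) a b z * z.2 i (idx k + idx c)
        + totalOne (horizontal Q k) a z * z.2 i (idx k + idx b + idx c)
        + totalOne (horizontal Q k) b z * z.2 i (idx k + idx a + idx c)
        + totalOne (horizontal Q k) c z * z.2 i (idx k + idx a + idx b)
        + horizontal Q k (toPoint z) * z.2 i (idx a + idx b + idx c + idx k)) := by
  rw [eqOn_totalDeriv hU (fun z hz => totalDeriv_totalDeriv_characteristic hU hQ hz i b c) a hz]
  have hξ := contDiffOn_horizontal hQ
  have hcoord := fun J => hasLineDerivAt_jetCoord i J z (jetShift a z)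
  have := HasDerivAt.fun_sub (hasLineDerivAt_totalTwo hU (contDiffOn_vertical hQ i) hz a b c)
    (HasDerivAt.fun_sum (u := Finset.univ) fun k _ => HasDerivAt.fun_add
      (HasDerivAt.fun_add (HasDerivAt.fun_add
        (hasLineDerivAt_mul (hasLineDerivAt_totalTwo hU (hξ k) hz a b c) (hcoord (idx k)))
        (hasLineDerivAt_mul (hasLineDerivAt_totalOne hU (hξ k) hz a c)
          (hcoord (idx k + idx b))))
        (hasLineDerivAt_mul (hasLineDerivAt_totalOne hU (hξ k) hz a b)
          (hcoord (idx k + idx c))))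
      (hasLineDerivAt_mul (hasLineDerivAt_comp_totalOne hU (hξ k) hz a)
        (hcoord (idx k + idx c + idx b))))
  refine totalDeriv_eq_of_hasLineDerivAt (HasDerivAt.congr_deriv this ?_)
  congr 1
  refine Finset.sum_congr rfl fun k _ => ?_
  simp only [jetShift]
  rw [show idx k + idx b + idx c = idx k + idx c + idx b by abel,
    show idx k + idx a + idx c = idx k + idx c + idx a by abel,
    show idx k + idx a + idx b = idx k + idx b + idx a by abel,
    show idx a + idx b + idx c + idx k = idx k + idx c + idx b + idx a by abel]
  ring

theorem prolongation_idx (hU : IsOpen U) (hQ : ContDiffOn ℝ ∞ Q U) (hz : toPoint z ∈ U)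
    (i : Fin m) (a : Fin 3) :
    (prolongation Q z).2 i (idx a) = totalOne (vertical Q i) a z
      - ∑ k, totalOne (horizontal Q k) a z * z.2 i (idx k) := by
  simp only [prolongation, totalDerivMulti_idx, totalDeriv_characteristic hU hQ hz,
    Finset.sum_add_distrib, horizontal, add_comm (idx a)]
  ring

theorem prolongation_idx_add_idx_add_idx (hU : IsOpen U) (hQ : ContDiffOn ℝ ∞ Q U)
    (hz : toPoint z ∈ U) (i : Fin m) {a b c : Fin 3} (hab : a ≤ b) (hbc : b ≤ c) :
    (prolongation Q z).2 i (idx a + idx b + idx c) = totalThree (vertical Q i) a b c z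
      - ∑ k, (totalThree (horizontal Q k) a b c z * z.2 i (idx k)
        + totalTwo (horizontal Q k) b c z * z.2 i (idx k + idx a)
        + totalTwo (horizontal Q k) a c z * z.2 i (idx k + idx b)
        + totalTwo (horizontal Q k) a b z * z.2 i (idx k + idx c)
        + totalOne (horizontal Q k) a z * z.2 i (idx k + idx b + idx c)
        + totalOne (horizontal Q k) b z * z.2 i (idx k + idx a + idx c)
        + totalOne (horizontal Q k) c z * z.2 i (idx k + idx a + idx b)) := by
  simp only [prolongation, totalDerivMulti_idx_add_idx_add_idx _ hab hbc,
    totalDeriv_totalDeriv_totalDeriv_characteristic hU hQ hz]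
  rw [Finset.sum_add_distrib]
  simp only [horizontal]
  ring

end Prolongation

section Equation

variable (f : Fin m → Fin m → ℝ) (β : ℝ) (i : Fin m)

theorem totalDeriv_vorticity (k : Fin 3) (z : JetSpace m) :
    totalDeriv k (vorticity f β i) z = z.2 i (idx 1 + idx 1 + idx k)
      + z.2 i (idx 2 + idx 2 + idx k) + coupling f i (fun j => z.2 j (idx k))
      + β * (Pi.single k 1 : Fin 3 → ℝ) 2 := by
  have := HasDerivAt.fun_add (HasDerivAt.fun_add (HasDerivAt.fun_add
    (hasLineDerivAt_jetCoord i (idx 1 + idx 1) z (jetShift k z))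
    (hasLineDerivAt_jetCoord i (idx 2 + idx 2) z (jetShift k z)))
    (hasLineDerivAt_coupling f i 0 z (jetShift k z)))
    (HasDerivAt.const_mul β (hasLineDerivAt_baseCoord 2 z (jetShift k z)))
  refine totalDeriv_eq_of_hasLineDerivAt (HasDerivAt.congr_deriv this ?_)
  simp only [jetShift, zero_add]

theorem qgEquation_eq :
    qgEquation f β i = fun z : JetSpace m =>
      z.2 i (idx 0 + idx 1 + idx 1) + z.2 i (idx 0 + idx 2 + idx 2)
      + coupling f i (fun j => z.2 j (idx 0))
      + z.2 i (idx 1) * (z.2 i (idx 1 + idx 1 + idx 2) + z.2 i (idx 2 + idx 2 + idx 2)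
        + coupling f i (fun j => z.2 j (idx 2)) + β)
      - z.2 i (idx 2) * (z.2 i (idx 1 + idx 1 + idx 1) + z.2 i (idx 1 + idx 2 + idx 2)
        + coupling f i (fun j => z.2 j (idx 1))) := by
  funext z
  simp only [qgEquation, totalDeriv_vorticity]
  rw [show idx 0 + idx 1 + idx 1 = idx 1 + idx 1 + idx 0 by abel,
    show idx 0 + idx 2 + idx 2 = idx 2 + idx 2 + idx 0 by abel,
    show idx 1 + idx 2 + idx 2 = idx 2 + idx 2 + idx 1 by abel]
  simp

theorem lineDeriv_qgEquation (z v : JetSpace m) :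
    lineDeriv ℝ (qgEquation f β i) z v =
      v.2 i (idx 0 + idx 1 + idx 1) + v.2 i (idx 0 + idx 2 + idx 2)
      + coupling f i (fun j => v.2 j (idx 0))
      + v.2 i (idx 1) * (z.2 i (idx 1 + idx 1 + idx 2) + z.2 i (idx 2 + idx 2 + idx 2)
        + coupling f i (fun j => z.2 j (idx 2)) + β)
      + z.2 i (idx 1) * (v.2 i (idx 1 + idx 1 + idx 2) + v.2 i (idx 2 + idx 2 + idx 2)
        + coupling f i (fun j => v.2 j (idx 2)))
      - v.2 i (idx 2) * (z.2 i (idx 1 + idx 1 + idx 1) + z.2 i (idx 1 + idx 2 + idx 2)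
        + coupling f i (fun j => z.2 j (idx 1)))
      - z.2 i (idx 2) * (v.2 i (idx 1 + idx 1 + idx 1) + v.2 i (idx 1 + idx 2 + idx 2)
        + coupling f i (fun j => v.2 j (idx 1))) := by
  have hc := fun J : Fin 3 → ℕ => hasLineDerivAt_jetCoord i J z v
  have hk := fun J : Fin 3 → ℕ => hasLineDerivAt_coupling f i J z v
  have hqy := HasDerivAt.add_const β (HasDerivAt.fun_add (HasDerivAt.fun_add
    (hc (idx 1 + idx 1 + idx 2)) (hc (idx 2 + idx 2 + idx 2))) (hk (idx 2)))
  have hqx := HasDerivAt.fun_add (HasDerivAt.fun_add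
    (hc (idx 1 + idx 1 + idx 1)) (hc (idx 1 + idx 2 + idx 2))) (hk (idx 1))
  have := HasDerivAt.fun_sub (HasDerivAt.fun_add (HasDerivAt.fun_add (HasDerivAt.fun_add
    (hc (idx 0 + idx 1 + idx 1)) (hc (idx 0 + idx 2 + idx 2))) (hk (idx 0)))
    (HasDerivAt.fun_mul (hc (idx 1)) hqy)) (HasDerivAt.fun_mul (hc (idx 2)) hqx)
  rw [qgEquation_eq]
  refine HasLineDerivAt.lineDeriv (HasDerivAt.congr_deriv this ?_)
  simp only [zero_smul, add_zero]
  ring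

end Equation

section FrozenCharacteristic

variable {U : Set (PointSpace m)} {Q : VField m}

theorem dirDeriv_horizontal (hU : IsOpen U) (hQ : ContDiffOn ℝ ∞ Q U) (v : PointSpace m)
    (k : Fin 3) : Set.EqOn (dirDeriv v (horizontal Q k)) (horizontal (dirDeriv v Q) k) U :=
  dirDeriv_clm_comp hU hQ (.proj (φ := fun _ => ℝ) k ∘L .fst ℝ _ _) v

theorem dirDeriv_vertical (hU : IsOpen U) (hQ : ContDiffOn ℝ ∞ Q U) (v : PointSpace m)
    (i : Fin m) : Set.EqOn (dirDeriv v (vertical Q i)) (vertical (dirDeriv v Q) i) U :=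
  dirDeriv_clm_comp hU hQ (.proj (φ := fun _ => ℝ) i ∘L .snd ℝ _ _) v

/-- The characteristic of `Q` in the layer `i` with the first-order derivatives of `ψⁱ` replaced by
the constants `b`. At a jet with these first-order derivatives and without second-order ones, the
iterated total derivatives of the characteristic involve the directional derivatives of this
function. -/
def frozenCharacteristic (Q : VField m) (i : Fin m) (b : Fin 3 → ℝ) (p : PointSpace m) : ℝ :=
  vertical Q i p - ∑ l, b l * horizontal Q l p

theorem dirDeriv_frozenCharacteristic (hU : IsOpen U) (hQ : ContDiffOn ℝ ∞ Q U)
    (v : PointSpace m) (i : Fin m) (b : Fin 3 → ℝ) :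
    Set.EqOn (dirDeriv v (frozenCharacteristic Q i b)) (frozenCharacteristic (dirDeriv v Q) i b)
      U := by
  let ℓ : PointSpace m →L[ℝ] ℝ :=
    .proj (φ := fun _ => ℝ) i ∘L .snd ℝ _ _
      - ∑ l, b l • (.proj (φ := fun _ => ℝ) l ∘L .fst ℝ _ _)
  have hℓ : ∀ R : VField m, frozenCharacteristic R i b = ℓ ∘ R := fun R => by
    funext p
    simp [frozenCharacteristic, vertical, horizontal, ℓ]
  simpa only [hℓ] using dirDeriv_clm_comp hU hQ ℓ v

theorem dirDeriv_frozenCharacteristic_apply (hU : IsOpen U) (hQ : ContDiffOn ℝ ∞ Q U)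
    (v : PointSpace m) (i : Fin m) (b : Fin 3 → ℝ) {p : PointSpace m} (hp : p ∈ U) :
    dirDeriv v (frozenCharacteristic Q i b) p
      = dirDeriv v (vertical Q i) p - ∑ l, b l * dirDeriv v (horizontal Q l) p := by
  simp only [dirDeriv_frozenCharacteristic hU hQ v i b hp, frozenCharacteristic,
    dirDeriv_vertical hU hQ v i hp, dirDeriv_horizontal hU hQ v _ hp]

theorem dirDeriv_dirDeriv_frozenCharacteristic_apply (hU : IsOpen U) (hQ : ContDiffOn ℝ ∞ Q U)
    (u v : PointSpace m) (i : Fin m) (b : Fin 3 → ℝ) {p : PointSpace m} (hp : p ∈ U) :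
    dirDeriv u (dirDeriv v (frozenCharacteristic Q i b)) p
      = dirDeriv u (dirDeriv v (vertical Q i)) p
        - ∑ l, b l * dirDeriv u (dirDeriv v (horizontal Q l)) p := by
  rw [eqOn_dirDeriv hU (dirDeriv_frozenCharacteristic hU hQ v i b) u hp,
    dirDeriv_frozenCharacteristic_apply hU (contDiffOn_dirDeriv hU hQ v) u i b hp]
  simp only [eqOn_dirDeriv hU (dirDeriv_vertical hU hQ v i) u hp,
    fun l => eqOn_dirDeriv hU (dirDeriv_horizontal hU hQ v l) u hp]

theorem dirDeriv_dirDeriv_dirDeriv_frozenCharacteristic_apply (hU : IsOpen U)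
    (hQ : ContDiffOn ℝ ∞ Q U) (u v w : PointSpace m) (i : Fin m) (b : Fin 3 → ℝ)
    {p : PointSpace m} (hp : p ∈ U) :
    dirDeriv u (dirDeriv v (dirDeriv w (frozenCharacteristic Q i b))) p
      = dirDeriv u (dirDeriv v (dirDeriv w (vertical Q i))) p
        - ∑ l, b l * dirDeriv u (dirDeriv v (dirDeriv w (horizontal Q l))) p := by
  have h₂ : ∀ {g h : PointSpace m → ℝ}, Set.EqOn g h U →
      dirDeriv u (dirDeriv v g) p = dirDeriv u (dirDeriv v h) p := fun hgh =>
    eqOn_dirDeriv hU (eqOn_dirDeriv hU hgh v) u hp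
  rw [h₂ (dirDeriv_frozenCharacteristic hU hQ w i b),
    dirDeriv_dirDeriv_frozenCharacteristic_apply hU (contDiffOn_dirDeriv hU hQ w) u v i b hp,
    h₂ (dirDeriv_vertical hU hQ w i)]
  simp only [fun l => h₂ (dirDeriv_horizontal hU hQ w l)]

end FrozenCharacteristic

section TestJet

variable {U : Set (PointSpace m)} {Q : VField m} {p : PointSpace m} {f : Fin m → Fin m → ℝ}
  {β : ℝ} (a : Fin m → Fin 3 → ℝ) (c d : Fin m → (Fin 3 → ℕ) → ℝ) (i : Fin m)

/-- The jet over the point `p` with the first-order derivatives `a`, the third-order derivatives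
`c` and vanishing derivatives of the other orders. -/
def oddJet (p : PointSpace m) (a : Fin m → Fin 3 → ℝ) (c : Fin m → (Fin 3 → ℕ) → ℝ) :
    JetSpace m :=
  (p.1, fun i J => match J 0 + J 1 + J 2 with
    | 0 => p.2 i
    | 1 => ∑ k, J k * a i k
    | 3 => c i J
    | _ => 0)

theorem degree_idx (k : Fin 3) : idx k 0 + idx k 1 + idx k 2 = 1 := by
  fin_cases k <;> simp [idx]

theorem toPoint_oddJet : toPoint (oddJet p a c) = p := rfl

theorem oddJet_idx (k : Fin 3) : (oddJet p a c).2 i (idx k) = a i k := by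
  simp only [oddJet, degree_idx]
  simp [idx, Pi.single_apply]

theorem oddJet_idx_two (k l : Fin 3) : (oddJet p a c).2 i (idx k + idx l) = 0 := by
  have h : (idx k + idx l) 0 + (idx k + idx l) 1 + (idx k + idx l) 2 = 2 := by
    have := degree_idx k; have := degree_idx l
    simp only [Pi.add_apply]; omega
  simp only [oddJet, h]

theorem oddJet_idx_three (k l n : Fin 3) :
    (oddJet p a c).2 i (idx k + idx l + idx n) = c i (idx k + idx l + idx n) := by
  have h : (idx k + idx l + idx n) 0 + (idx k + idx l + idx n) 1 + (idx k + idx l + idx n) 2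
      = 3 := by
    have := degree_idx k; have := degree_idx l; have := degree_idx n
    simp only [Pi.add_apply]; omega
  simp only [oddJet, h]

/-- The vector `∂_k + ∑ aⁱ_k ∂_{ψⁱ}`: the total derivative `D_k` acts along it at a jet with the
first-order derivatives `a`. -/
def slopeVec (a : Fin m → Fin 3 → ℝ) (k : Fin 3) : PointSpace m :=
  (Pi.single k 1, fun i => a i k)

theorem tangentVec_oddJet (k : Fin 3) : tangentVec k (oddJet p a c) = slopeVec a k := by
  simp only [tangentVec, slopeVec, oddJet_idx]

theorem fibreVec_oddJet_two (k l : Fin 3) : fibreVec (idx k + idx l) (oddJet p a c) = 0 := by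
  simp only [fibreVec, oddJet_idx_two]; rfl

theorem fibreVec_oddJet_three (k l n : Fin 3) :
    fibreVec (idx k + idx l + idx n) (oddJet p a c)
      = (0, fun j => c j (idx k + idx l + idx n)) := by
  simp only [fibreVec, oddJet_idx_three]

theorem prolongation_oddJet_idx (hU : IsOpen U) (hQ : ContDiffOn ℝ ∞ Q U) (hp : p ∈ U)
    (k : Fin 3) : (prolongation Q (oddJet p a c)).2 i (idx k)
      = dirDeriv (slopeVec a k) (frozenCharacteristic Q i (a i)) p := by
  rw [prolongation_idx hU hQ (by exact hp), dirDeriv_frozenCharacteristic_apply hU hQ _ _ _ hp]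
  simp only [totalOne, toPoint_oddJet, tangentVec_oddJet, oddJet_idx, dirDeriv, mul_comm]

/-- The part of the prolongation coefficient at `ψⁱ_{krs}` that is linear in the third-order
derivatives `c`, at a jet with the first-order derivatives `a` and without second-order ones. -/
def thirdCoeffPrincipal (Q : VField m) (a : Fin m → Fin 3 → ℝ) (c : Fin m → (Fin 3 → ℕ) → ℝ)
    (p : PointSpace m) (i : Fin m) (k r s : Fin 3) : ℝ :=
  dirDeriv (0, fun j => c j (idx k + idx r + idx s)) (frozenCharacteristic Q i (a i)) p
    - ∑ l, (dirDeriv (slopeVec a k) (horizontal Q l) p * c i (idx l + idx r + idx s)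
      + dirDeriv (slopeVec a r) (horizontal Q l) p * c i (idx l + idx k + idx s)
      + dirDeriv (slopeVec a s) (horizontal Q l) p * c i (idx l + idx k + idx r))

/-- The part of the prolongation coefficient at `ψⁱ_{krs}` that does not involve the third-order
derivatives, at a jet with the first-order derivatives `a` and without second-order ones. -/
def thirdCoeffLower (Q : VField m) (a : Fin m → Fin 3 → ℝ) (p : PointSpace m) (i : Fin m)
    (k r s : Fin 3) : ℝ :=
  dirDeriv (slopeVec a k) (dirDeriv (slopeVec a r)
    (dirDeriv (slopeVec a s) (frozenCharacteristic Q i (a i)))) p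

theorem prolongation_oddJet_idx_three (hU : IsOpen U) (hQ : ContDiffOn ℝ ∞ Q U) (hp : p ∈ U)
    {k r s : Fin 3} (hkr : k ≤ r) (hrs : r ≤ s) :
    (prolongation Q (oddJet p a c)).2 i (idx k + idx r + idx s)
      = thirdCoeffPrincipal Q a c p i k r s + thirdCoeffLower Q a p i k r s := by
  rw [prolongation_idx_add_idx_add_idx hU hQ (by exact hp) i hkr hrs,
    thirdCoeffPrincipal, thirdCoeffLower, dirDeriv_frozenCharacteristic_apply hU hQ _ _ _ hp,
    dirDeriv_dirDeriv_dirDeriv_frozenCharacteristic_apply hU hQ _ _ _ _ _ hp,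
    dirDeriv_dirDeriv_dirDeriv hU (contDiffOn_vertical hQ i) _ _ _ hp]
  simp only [fun l => dirDeriv_dirDeriv_dirDeriv hU (contDiffOn_horizontal hQ l) (slopeVec a k)
      (slopeVec a r) (slopeVec a s) hp]
  simp only [totalOne, totalThree, toPoint_oddJet, tangentVec_oddJet, oddJet_idx,
    oddJet_idx_two, oddJet_idx_three, fibreVec_oddJet_two, fibreVec_oddJet_three,
    map_zero, zero_apply, dirDeriv,
    show idx s + idx r + idx k = idx k + idx r + idx s by abel,
    mul_zero, add_zero, add_mul, Finset.sum_add_distrib, mul_comm (a i _)]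
  ring

/-- The expression `ζ_t + ψ_x ζ_y - ψ_y ζ_x`, where `ζ = ψ_xx + ψ_yy`, for a function `ψ` with the
first-order derivatives `b` and the third-order derivatives `T k r s = ψ_{krs}`, `k ≤ r ≤ s`. -/
def vorticityTransport (b : Fin 3 → ℝ) (T : Fin 3 → Fin 3 → Fin 3 → ℝ) : ℝ :=
  T 0 1 1 + T 0 2 2 + b 1 * (T 1 1 2 + T 2 2 2) - b 2 * (T 1 1 1 + T 1 2 2)

/-- The part of the `i`th equation that is linear in the third-order derivatives. -/
def qgPrincipal (a : Fin m → Fin 3 → ℝ) (c : Fin m → (Fin 3 → ℕ) → ℝ) (i : Fin m) : ℝ :=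
  vorticityTransport (a i) fun k r s => c i (idx k + idx r + idx s)

/-- The part of the `i`th equation that does not involve the third-order derivatives. -/
def qgLower (f : Fin m → Fin m → ℝ) (β : ℝ) (a : Fin m → Fin 3 → ℝ) (i : Fin m) : ℝ :=
  coupling f i (fun j => a j 0) + a i 1 * (coupling f i (fun j => a j 2) + β)
    - a i 2 * coupling f i (fun j => a j 1)

theorem qgEquation_oddJet :
    qgEquation f β i (oddJet p a c) = qgPrincipal a c i + qgLower f β a i := by
  simp only [qgEquation_eq, oddJet_idx, oddJet_idx_three, qgPrincipal, vorticityTransport, qgLower]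
  ring

/-- The part of the infinitesimal invariance criterion for the `i`th equation that is linear in the
third-order derivatives, at a jet without second-order ones. -/
def criterionPrincipal (Q : VField m) (a : Fin m → Fin 3 → ℝ) (c : Fin m → (Fin 3 → ℕ) → ℝ)
    (p : PointSpace m) (i : Fin m) : ℝ :=
  vorticityTransport (a i) (thirdCoeffPrincipal Q a c p i)
    + dirDeriv (slopeVec a 1) (frozenCharacteristic Q i (a i)) p
      * (c i (idx 1 + idx 1 + idx 2) + c i (idx 2 + idx 2 + idx 2))
    - dirDeriv (slopeVec a 2) (frozenCharacteristic Q i (a i)) p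
      * (c i (idx 1 + idx 1 + idx 1) + c i (idx 1 + idx 2 + idx 2))

/-- The part of the infinitesimal invariance criterion for the `i`th equation that does not involve
the third-order derivatives, at a jet without second-order ones. -/
def criterionLower (f : Fin m → Fin m → ℝ) (β : ℝ) (Q : VField m) (a : Fin m → Fin 3 → ℝ)
    (p : PointSpace m) (i : Fin m) : ℝ :=
  let φ : Fin 3 → Fin m → ℝ := fun k j =>
    dirDeriv (slopeVec a k) (frozenCharacteristic Q j (a j)) p
  vorticityTransport (a i) (thirdCoeffLower Q a p i) + coupling f i (φ 0)
    + φ 1 i * (coupling f i (fun j => a j 2) + β) + a i 1 * coupling f i (φ 2)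
    - φ 2 i * coupling f i (fun j => a j 1) - a i 2 * coupling f i (φ 1)

theorem lineDeriv_qgEquation_prolongation_oddJet (hU : IsOpen U) (hQ : ContDiffOn ℝ ∞ Q U)
    (hp : p ∈ U) :
    lineDeriv ℝ (qgEquation f β i) (oddJet p a c) (prolongation Q (oddJet p a c))
      = criterionPrincipal Q a c p i + criterionLower f β Q a p i := by
  have h₃ := fun k r s => prolongation_oddJet_idx_three a c i hU hQ hp (k := k) (r := r) (s := s)
  rw [lineDeriv_qgEquation, h₃ 0 1 1 (by decide) (by decide), h₃ 0 2 2 (by decide) (by decide),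
    h₃ 1 1 2 (by decide) (by decide), h₃ 2 2 2 (by decide) (by decide),
    h₃ 1 1 1 (by decide) (by decide), h₃ 1 2 2 (by decide) (by decide)]
  simp only [prolongation_oddJet_idx a c _ hU hQ hp, oddJet_idx, oddJet_idx_three,
    criterionPrincipal, criterionLower, vorticityTransport]
  ring

theorem criterionPrincipal_add :
    criterionPrincipal Q a (c + d) p i
      = criterionPrincipal Q a c p i + criterionPrincipal Q a d p i := by
  have h : ∀ J : Fin 3 → ℕ, ((0, fun j => c j J + d j J) : PointSpace m)
      = (0, fun j => c j J) + (0, fun j => d j J) := fun J =>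
    Prod.ext (add_zero 0).symm rfl
  simp only [criterionPrincipal, vorticityTransport, thirdCoeffPrincipal, Pi.add_apply, h,
    dirDeriv_add_dir, mul_add, Finset.sum_add_distrib]
  ring

variable {c d}

theorem IsLieSymmetryOn.criterion (hU : IsOpen U) (hQ : IsLieSymmetryOn f β U Q) (hp : p ∈ U)
    (hc : ∀ i, qgPrincipal a c i + qgLower f β a i = 0) :
    criterionPrincipal Q a c p i + criterionLower f β Q a p i = 0 := by
  rw [← lineDeriv_qgEquation_prolongation_oddJet a c i hU hQ.1 hp]
  exact hQ.2 (oddJet p a c) (by exact hp) (fun j => (qgEquation_oddJet a c j).trans (hc j)) i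

/-- Third-order derivatives, only of the form `ψⁱ_txx`, that solve the equations together with
the first-order derivatives `a`. -/
def solvingCubic (f : Fin m → Fin m → ℝ) (β : ℝ) (a : Fin m → Fin 3 → ℝ) (i : Fin m) :
    (Fin 3 → ℕ) → ℝ :=
  Pi.single (idx 0 + idx 1 + idx 1) (-qgLower f β a i)

theorem qgPrincipal_solvingCubic_add_qgLower :
    qgPrincipal a (solvingCubic f β a) i + qgLower f β a i = 0 := by
  simp [qgPrincipal, solvingCubic, vorticityTransport, Pi.single_apply, funext_iff,
    Fin.forall_fin_succ, idx]

theorem IsLieSymmetryOn.criterionPrincipal_eq_zero (hU : IsOpen U)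
    (hQ : IsLieSymmetryOn f β U Q) (hp : p ∈ U) (hd : ∀ i, qgPrincipal a d i = 0) :
    criterionPrincipal Q a d p i = 0 := by
  have hc := qgPrincipal_solvingCubic_add_qgLower (f := f) (β := β) a
  have h₁ := hQ.criterion a i hU hp hc
  have h₂ := hQ.criterion a (c := solvingCubic f β a + d) i hU hp fun j => by
    rw [← hc j, ← add_zero (qgPrincipal a (solvingCubic f β a) j), ← hd j]
    simp only [qgPrincipal, vorticityTransport, Pi.add_apply]
    ring
  rw [criterionPrincipal_add] at h₂
  linarith

end TestJet

section FirstOrder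

variable {U : Set (PointSpace m)} {Q : VField m} {p : PointSpace m} {f : Fin m → Fin m → ℝ}
  {β : ℝ}

/-- The vector `∂_k` in the space of points. -/
def baseVec (k : Fin 3) : PointSpace m := (Pi.single k 1, 0)

/-- The vector `∂_{ψʲ}` in the space of points. -/
def layerVec (j : Fin m) : PointSpace m := (0, Pi.single j 1)

theorem slopeVec_eq (a : Fin m → Fin 3 → ℝ) (k : Fin 3) :
    slopeVec a k = baseVec k + (0, fun i => a i k) := by
  simp [slopeVec, baseVec]

theorem slopeVec_single (i : Fin m) (b : Fin 3 → ℝ) (k : Fin 3) :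
    slopeVec (Pi.single i b) k = baseVec k + b k • layerVec i := by
  ext j
  · simp [slopeVec, baseVec, layerVec]
  · rcases eq_or_ne j i with rfl | hji <;> simp [slopeVec, baseVec, layerVec, *]

theorem fibre_single (i : Fin m) (g : (Fin 3 → ℕ) → ℝ) (J : Fin 3 → ℕ) :
    ((0, fun j => (Pi.single i g : Fin m → (Fin 3 → ℕ) → ℝ) j J) : PointSpace m)
      = g J • layerVec i := by
  ext j
  · simp [layerVec]
  · rcases eq_or_ne j i with rfl | hji <;> simp [layerVec, *]

theorem IsLieSymmetryOn.dirDeriv_other_layers (hU : IsOpen U) (hQ : IsLieSymmetryOn f β U Q)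
    (hp : p ∈ U) {i : Fin m} {u : Fin m → ℝ} (hu : u i = 0) {b : Fin 3 → ℝ} (hb : b 1 ≠ 0) :
    dirDeriv (0, u) (frozenCharacteristic Q i b) p = 0 := by
  have hd := hQ.criterionPrincipal_eq_zero (Pi.single i b)
    (d := fun j => Pi.single (idx 2 + idx 2 + idx 2) (u j)) i hU hp fun j => by
      rcases eq_or_ne j i with rfl | hji
      · simp [qgPrincipal, vorticityTransport, hu]
      · simp +decide [qgPrincipal, vorticityTransport, hji]
  have h₀ : dirDeriv (0, fun _ : Fin m => 0) (frozenCharacteristic Q i b) p = 0 := map_zero _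
  simpa +decide [criterionPrincipal, vorticityTransport, thirdCoeffPrincipal, hu, hb,
    Pi.single_apply, h₀] using hd

theorem IsLieSymmetryOn.dirDeriv_other_layers_eq_zero (hU : IsOpen U)
    (hQ : IsLieSymmetryOn f β U Q) (hp : p ∈ U) {i : Fin m} {u : Fin m → ℝ} (hu : u i = 0) :
    dirDeriv (0, u) (vertical Q i) p = 0 ∧ ∀ k, dirDeriv (0, u) (horizontal Q k) p = 0 := by
  have hW : ∀ b : Fin 3 → ℝ, b 1 ≠ 0 → dirDeriv (0, u) (vertical Q i) p
      - (b 0 * dirDeriv (0, u) (horizontal Q 0) p + b 1 * dirDeriv (0, u) (horizontal Q 1) p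
        + b 2 * dirDeriv (0, u) (horizontal Q 2) p) = 0 := fun b hb => by
    rw [← Fin.sum_univ_three fun l => b l * dirDeriv (0, u) (horizontal Q l) p,
      ← dirDeriv_frozenCharacteristic_apply hU hQ.1 (0, u) i b hp]
    exact hQ.dirDeriv_other_layers hU hp hu hb
  have h₀ := hW ![0, 1, 0] one_ne_zero
  have h₁ := hW ![0, 2, 0] two_ne_zero
  have h₂ := hW ![1, 1, 0] one_ne_zero
  have h₃ := hW ![0, 1, 1] one_ne_zero
  simp only [Matrix.cons_val] at h₀ h₁ h₂ h₃
  refine ⟨by linarith, fun k => ?_⟩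
  fin_cases k <;> simp only [Fin.zero_eta, Fin.mk_one, Fin.reduceFinMk] <;> linarith

theorem IsLieSymmetryOn.dirDeriv_fibre_horizontal (hm : 2 ≤ m) (hU : IsOpen U)
    (hQ : IsLieSymmetryOn f β U Q) (hp : p ∈ U) (u : Fin m → ℝ) (k : Fin 3) :
    dirDeriv (0, u) (horizontal Q k) p = 0 := by
  have : Nontrivial (Fin m) := Fin.nontrivial_iff_two_le.2 hm
  obtain ⟨i, j, hij⟩ := exists_pair_ne (Fin m)
  have hu : ((0, u) : PointSpace m) = (0, u - Pi.single i (u i)) + (0, Pi.single i (u i)) := by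
    simp
  rw [hu, dirDeriv_add_dir, Pi.add_apply,
    (hQ.dirDeriv_other_layers_eq_zero hU hp (i := i) (by simp)).2 k,
    (hQ.dirDeriv_other_layers_eq_zero hU hp (i := j) (by simp [hij.symm])).2 k, add_zero]

theorem IsLieSymmetryOn.single_layer_criterion (hm : 2 ≤ m) (hU : IsOpen U)
    (hQ : IsLieSymmetryOn f β U Q) (hp : p ∈ U) (i : Fin m) (b : Fin 3 → ℝ)
    (g : (Fin 3 → ℕ) → ℝ)
    (hg : vorticityTransport b (fun k r s => g (idx k + idx r + idx s)) = 0) :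
    let X := fun k l => dirDeriv (baseVec k) (horizontal Q l) p
    let φ := fun k => dirDeriv (baseVec k) (vertical Q i) p
      + b k * dirDeriv (layerVec i) (vertical Q i) p - ∑ l, b l * X k l
    φ 1 * (g (idx 1 + idx 1 + idx 2) + g (idx 2 + idx 2 + idx 2))
        - φ 2 * (g (idx 1 + idx 1 + idx 1) + g (idx 1 + idx 2 + idx 2))
      = vorticityTransport b fun k r s => ∑ l, (X k l * g (idx l + idx r + idx s)
        + X r l * g (idx l + idx k + idx s) + X s l * g (idx l + idx k + idx r)) := by
  intro X φ
  have hX : ∀ k l, dirDeriv (slopeVec (Pi.single i b) k) (horizontal Q l) p = X k l := fun k l => by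
    rw [slopeVec_eq, dirDeriv_add_dir, Pi.add_apply, hQ.dirDeriv_fibre_horizontal hm hU hp,
      add_zero]
  have hlayer : dirDeriv (layerVec i) (frozenCharacteristic Q i b) p
      = dirDeriv (layerVec i) (vertical Q i) p := by
    simp only [dirDeriv_frozenCharacteristic_apply hU hQ.1 _ i b hp, layerVec,
      hQ.dirDeriv_fibre_horizontal hm hU hp, mul_zero, Finset.sum_const_zero, sub_zero]
  have hφ : ∀ k, dirDeriv (slopeVec (Pi.single i b) k) (frozenCharacteristic Q i b) p = φ k :=
    fun k => by
      rw [slopeVec_single, dirDeriv_add_dir, dirDeriv_smul_dir, Pi.add_apply, Pi.smul_apply,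
        hlayer, dirDeriv_frozenCharacteristic_apply hU hQ.1 _ i b hp, smul_eq_mul]
      ring
  have hfibre : ∀ J, dirDeriv (0, fun j => (Pi.single i g : Fin m → (Fin 3 → ℕ) → ℝ) j J)
      (frozenCharacteristic Q i b) p = dirDeriv (layerVec i) (vertical Q i) p * g J := fun J => by
    rw [fibre_single, dirDeriv_smul_dir, Pi.smul_apply, hlayer, smul_eq_mul, mul_comm]
  have hcrit := hQ.criterionPrincipal_eq_zero (Pi.single i b) (d := Pi.single i g) i hU hp
    fun j => by
      rcases eq_or_ne j i with rfl | hji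
      · simpa [qgPrincipal] using hg
      · simp [qgPrincipal, vorticityTransport, hji]
  simp only [criterionPrincipal, vorticityTransport, thirdCoeffPrincipal, Pi.single_eq_same, hX, hφ,
    hfibre] at hcrit hg ⊢
  linear_combination hcrit - dirDeriv (layerVec i) (vertical Q i) p * hg

theorem IsLieSymmetryOn.tau_x_eq_zero_and_tau_y_eq_zero (hm : 2 ≤ m) (hU : IsOpen U)
    (hQ : IsLieSymmetryOn f β U Q) (hp : p ∈ U) :
    dirDeriv (baseVec 1) (horizontal Q 0) p = 0 ∧ dirDeriv (baseVec 2) (horizontal Q 0) p = 0 := by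
  have crit := hQ.single_layer_criterion hm hU hp ⟨0, by omega⟩ 0
  constructor
  · have h := crit (Pi.single (idx 0 + idx 0 + idx 1) 1)
      (by simp +decide [vorticityTransport])
    simpa +decide [vorticityTransport, Pi.single_apply, Fin.sum_univ_three] using h.symm
  · have h := crit (Pi.single (idx 0 + idx 0 + idx 2) 1)
      (by simp +decide [vorticityTransport])
    simpa +decide [vorticityTransport, Pi.single_apply, Fin.sum_univ_three] using h.symm

theorem IsLieSymmetryOn.cauchyRiemann (hm : 2 ≤ m) (hU : IsOpen U)
    (hQ : IsLieSymmetryOn f β U Q) (hp : p ∈ U) :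
    dirDeriv (baseVec 2) (horizontal Q 2) p = dirDeriv (baseVec 1) (horizontal Q 1) p ∧
      dirDeriv (baseVec 2) (horizontal Q 1) p = -dirDeriv (baseVec 1) (horizontal Q 2) p := by
  let X : Fin 3 → Fin 3 → ℝ := fun k l => dirDeriv (baseVec k) (horizontal Q l) p
  have crit := hQ.single_layer_criterion hm hU hp ⟨0, by omega⟩ 0
  have h_diag : X 0 0 + (X 1 1 + X 1 1) + (-X 0 0 + (-X 2 2 + -X 2 2)) = 0 := by
    have h := crit (Pi.single (idx 0 + idx 1 + idx 1) 1 - Pi.single (idx 0 + idx 2 + idx 2) 1)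
      (by simp +decide [vorticityTransport])
    simpa +decide [vorticityTransport, Pi.single_apply, Fin.sum_univ_three] using h.symm
  have h_off_diag : X 1 2 + X 1 2 + (X 2 1 + X 2 1) = 0 := by
    have h := crit (Pi.single (idx 0 + idx 1 + idx 2) 1)
      (by simp +decide [vorticityTransport])
    simpa +decide [vorticityTransport, Pi.single_apply, Fin.sum_univ_three] using h.symm
  exact ⟨by linarith, by linarith⟩

/-- The determining equations of first order: those that come from the part of the infinitesimal
invariance criterion that is linear in the third-order derivatives. -/
structure FirstOrderDeterminingEquations (Q : VField m) (p : PointSpace m) : Prop where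
  fibre_horizontal : ∀ u k, dirDeriv (0, u) (horizontal Q k) p = 0
  fibre_vertical : ∀ i (u : Fin m → ℝ), u i = 0 → dirDeriv (0, u) (vertical Q i) p = 0
  tau_x : dirDeriv (baseVec 1) (horizontal Q 0) p = 0
  tau_y : dirDeriv (baseVec 2) (horizontal Q 0) p = 0
  xiY_y : dirDeriv (baseVec 2) (horizontal Q 2) p = dirDeriv (baseVec 1) (horizontal Q 1) p
  xiX_y : dirDeriv (baseVec 2) (horizontal Q 1) p = -dirDeriv (baseVec 1) (horizontal Q 2) p
  eta_x : ∀ i, dirDeriv (baseVec 1) (vertical Q i) p = dirDeriv (baseVec 0) (horizontal Q 2) p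
  eta_y : ∀ i, dirDeriv (baseVec 2) (vertical Q i) p = -dirDeriv (baseVec 0) (horizontal Q 1) p
  eta_psi : ∀ i, dirDeriv (layerVec i) (vertical Q i) p
    = 2 * dirDeriv (baseVec 1) (horizontal Q 1) p - dirDeriv (baseVec 0) (horizontal Q 0) p

theorem IsLieSymmetryOn.firstOrderDeterminingEquations (hm : 2 ≤ m) (hU : IsOpen U)
    (hQ : IsLieSymmetryOn f β U Q) (hp : p ∈ U) : FirstOrderDeterminingEquations Q p := by
  let X : Fin 3 → Fin 3 → ℝ := fun k l => dirDeriv (baseVec k) (horizontal Q l) p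
  let Y : Fin 3 → Fin m → ℝ := fun k i => dirDeriv (baseVec k) (vertical Q i) p
  have crit := hQ.single_layer_criterion hm hU hp
  obtain ⟨tau_x, tau_y⟩ := hQ.tau_x_eq_zero_and_tau_y_eq_zero hm hU hp
  obtain ⟨xiY_y, xiX_y⟩ := hQ.cauchyRiemann hm hU hp
  have eta_x : ∀ i, Y 1 i = X 0 2 := fun i => by
    have h := crit i 0 (Pi.single (idx 2 + idx 2 + idx 2) 1)
      (by simp +decide [vorticityTransport])
    simpa +decide [vorticityTransport, Pi.single_apply, Fin.sum_univ_three] using h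
  have eta_y : ∀ i, -Y 2 i = X 0 1 := fun i => by
    have h := crit i 0 (Pi.single (idx 1 + idx 1 + idx 1) 1)
      (by simp +decide [vorticityTransport])
    simpa +decide [vorticityTransport, Pi.single_apply, Fin.sum_univ_three] using h
  have eta_psi : ∀ i, X 2 2 - (Y 2 i + dirDeriv (layerVec i) (vertical Q i) p)
      = X 0 0 + (X 0 1 + X 1 1 + X 1 1) - (X 1 0 + X 1 0 + X 1 0 + (X 1 1 + X 1 1 + X 1 1)) :=
    fun i => by
      have h := crit i ![0, 0, 1]
        (Pi.single (idx 1 + idx 1 + idx 1) 1 + Pi.single (idx 0 + idx 1 + idx 1) 1)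
        (by simp +decide [vorticityTransport])
      simpa +decide [vorticityTransport, Pi.single_apply, Fin.sum_univ_three] using h
  exact {
    fibre_horizontal := hQ.dirDeriv_fibre_horizontal hm hU hp
    fibre_vertical := fun _ _ hu => (hQ.dirDeriv_other_layers_eq_zero hU hp hu).1
    tau_x, tau_y, xiY_y, xiX_y, eta_x
    eta_y := fun i => by linarith [eta_y i]
    eta_psi := fun i => by linarith [eta_y i, eta_psi i] }

end FirstOrder

section Stretch

variable {U : Set (PointSpace m)} {Q : VField m} {p : PointSpace m} {f : Fin m → Fin m → ℝ}
  {β : ℝ}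

namespace FirstOrderDeterminingEquations

theorem dirDeriv_slopeVec_horizontal (h : FirstOrderDeterminingEquations Q p)
    (a : Fin m → Fin 3 → ℝ) (k l : Fin 3) :
    dirDeriv (slopeVec a k) (horizontal Q l) p = dirDeriv (baseVec k) (horizontal Q l) p := by
  rw [slopeVec_eq, dirDeriv_add_dir, Pi.add_apply, h.fibre_horizontal, add_zero]

theorem dirDeriv_fibre_vertical (h : FirstOrderDeterminingEquations Q p) (i : Fin m)
    (u : Fin m → ℝ) : dirDeriv (0, u) (vertical Q i) p
      = u i * (2 * dirDeriv (baseVec 1) (horizontal Q 1) p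
        - dirDeriv (baseVec 0) (horizontal Q 0) p) := by
  have hu : ((0, u) : PointSpace m) = (0, u - Pi.single i (u i)) + u i • layerVec i := by
    simp [layerVec, ← Pi.single_smul]
  rw [hu, dirDeriv_add_dir, dirDeriv_smul_dir, Pi.add_apply, Pi.smul_apply,
    h.fibre_vertical i _ (by simp), zero_add, h.eta_psi, smul_eq_mul]

theorem dirDeriv_slopeVec_frozenCharacteristic (h : FirstOrderDeterminingEquations Q p)
    (hU : IsOpen U) (hQ : ContDiffOn ℝ ∞ Q U) (hp : p ∈ U) (a : Fin m → Fin 3 → ℝ) (i : Fin m)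
    (k : Fin 3) : dirDeriv (slopeVec a k) (frozenCharacteristic Q i (a i)) p
      = dirDeriv (baseVec k) (vertical Q i) p
        + a i k * (2 * dirDeriv (baseVec 1) (horizontal Q 1) p
          - dirDeriv (baseVec 0) (horizontal Q 0) p)
        - ∑ l, a i l * dirDeriv (baseVec k) (horizontal Q l) p := by
  simp only [dirDeriv_frozenCharacteristic_apply hU hQ _ i _ hp, h.dirDeriv_slopeVec_horizontal]
  rw [slopeVec_eq, dirDeriv_add_dir, Pi.add_apply, h.dirDeriv_fibre_vertical]

theorem criterionPrincipal_solvingCubic (h : FirstOrderDeterminingEquations Q p)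
    (hU : IsOpen U) (hQ : ContDiffOn ℝ ∞ Q U) (hp : p ∈ U) (a : Fin m → Fin 3 → ℝ) (i : Fin m) :
    criterionPrincipal Q a (solvingCubic f β a) p i
      = 2 * dirDeriv (baseVec 0) (horizontal Q 0) p * qgLower f β a i := by
  have hW : ∀ u : Fin m → ℝ, dirDeriv (0, u) (frozenCharacteristic Q i (a i)) p
      = u i * (2 * dirDeriv (baseVec 1) (horizontal Q 1) p
        - dirDeriv (baseVec 0) (horizontal Q 0) p) := fun u => by
    simp only [dirDeriv_frozenCharacteristic_apply hU hQ _ i _ hp, h.fibre_horizontal,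
      h.dirDeriv_fibre_vertical, mul_zero, Finset.sum_const_zero, sub_zero]
  simp +decide only [criterionPrincipal, vorticityTransport, thirdCoeffPrincipal, solvingCubic,
    Pi.single_eq_same, hW, neg_mul, h.dirDeriv_slopeVec_horizontal, Pi.single_apply, add_left_inj,
    mul_ite, mul_neg, mul_zero, Fin.sum_univ_three, ↓reduceIte, add_zero, zero_add, zero_mul,
    sub_self, h.tau_y, neg_zero, h.tau_x, sub_zero]
  ring

end FirstOrderDeterminingEquations

theorem IsLieSymmetryOn.criterionLower_add_eq_zero (hm : 2 ≤ m) (hU : IsOpen U)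
    (hQ : IsLieSymmetryOn f β U Q) (hp : p ∈ U) (a : Fin m → Fin 3 → ℝ) (i : Fin m) :
    criterionLower f β Q a p i
      + 2 * dirDeriv (baseVec 0) (horizontal Q 0) p * qgLower f β a i = 0 := by
  rw [← (hQ.firstOrderDeterminingEquations hm hU hp).criterionPrincipal_solvingCubic hU hQ.1 hp,
    add_comm]
  exact hQ.criterion a i hU hp (qgPrincipal_solvingCubic_add_qgLower a)

theorem thirdCoeffLower_time_slopes (hU : IsOpen U) (hQ : ContDiffOn ℝ ∞ Q U)
    (h : ∀ q ∈ U, FirstOrderDeterminingEquations Q q) (hp : p ∈ U) {i : Fin m} {u : Fin m → ℝ}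
    (hu : u i = 0) {k : Fin 3} (hk : k ≠ 0) :
    thirdCoeffLower Q (fun j => Pi.single 0 (u j)) p i 0 k k
      = dirDeriv (baseVec 0) (dirDeriv (baseVec k) (dirDeriv (baseVec k) (vertical Q i))) p := by
  have hη := contDiffOn_vertical hQ i
  have hW : frozenCharacteristic Q i (Pi.single 0 (u i)) = vertical Q i := by
    funext q
    simp [frozenCharacteristic, hu]
  have hk' : slopeVec (fun j => Pi.single 0 (u j)) k = (baseVec k : PointSpace m) := by
    simp only [slopeVec, baseVec, Pi.single_eq_of_ne hk]; rfl
  have hfibre := eqOn_dirDeriv_dirDeriv_zero hU (contDiffOn_dirDeriv hU hη (baseVec k))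
    (eqOn_dirDeriv_dirDeriv_zero hU hη (fun q hq => (h q hq).fibre_vertical i u hu) (baseVec k))
    (baseVec k)
  rw [thirdCoeffLower, hW, hk', slopeVec_eq, dirDeriv_add_dir, Pi.add_apply]
  simpa using hfibre hp

theorem IsLieSymmetryOn.criterion_time_slopes (hm : 2 ≤ m) (hU : IsOpen U)
    (hQ : IsLieSymmetryOn f β U Q) (hp : p ∈ U) {i : Fin m} {u : Fin m → ℝ} (hu : u i = 0) :
    let D : Fin 3 → (PointSpace m → ℝ) → PointSpace m → ℝ := fun k => dirDeriv (baseVec k)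
    D 0 (D 1 (D 1 (vertical Q i))) p + D 0 (D 2 (D 2 (vertical Q i))) p
      + coupling f i (fun j => D 0 (vertical Q j) p) + D 1 (vertical Q i) p * β
      + 2 * D 1 (horizontal Q 1) p * coupling f i u = 0 := by
  intro D
  have h := fun q hq => hQ.firstOrderDeterminingEquations hm hU (p := q) hq
  have hcrit := hQ.criterionLower_add_eq_zero hm hU hp (fun j => Pi.single 0 (u j)) i
  have hφ := fun k j => (h p hp).dirDeriv_slopeVec_frozenCharacteristic hU hQ.1 hp
    (fun j => Pi.single 0 (u j)) j k
  have hφ₀ : (fun j => D 0 (vertical Q j) p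
      + u j * (2 * D 1 (horizontal Q 1) p - D 0 (horizontal Q 0) p) - u j * D 0 (horizontal Q 0) p)
      = (fun j => D 0 (vertical Q j) p)
        + (2 * (D 1 (horizontal Q 1) p - D 0 (horizontal Q 0) p)) • u := by
    funext j
    simp only [Pi.add_apply, Pi.smul_apply, smul_eq_mul]
    ring
  have hT := fun {k : Fin 3} => thirdCoeffLower_time_slopes hU hQ.1 h hp hu (k := k)
  simp only [criterionLower, vorticityTransport, qgLower, hφ] at hcrit
  have hcrit' : D 0 (D 1 (D 1 (vertical Q i))) p + D 0 (D 2 (D 2 (vertical Q i))) p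
      + coupling f i (fun j => D 0 (vertical Q j) p
        + u j * (2 * D 1 (horizontal Q 1) p - D 0 (horizontal Q 0) p)
        - u j * D 0 (horizontal Q 0) p)
      + D 1 (vertical Q i) p * β + 2 * D 0 (horizontal Q 0) p * coupling f i u = 0 := by
    have hcoupling₀ : coupling f i (fun _ : Fin m => (0 : ℝ)) = 0 := coupling_const f i 0
    simpa [hT, hu, hcoupling₀, Fin.sum_univ_three] using hcrit
  rw [hφ₀, map_add, map_smul, smul_eq_mul] at hcrit'
  linear_combination hcrit'

theorem IsLieSymmetryOn.xiX_x_eq_zero (hm : 2 ≤ m) (hU : IsOpen U)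
    (hQ : IsLieSymmetryOn f β U Q)
    (hf : ∀ i j : Fin m, i.val + 1 = j.val → 0 < f i j * f j i) :
    Set.EqOn (dirDeriv (baseVec 1) (horizontal Q 1)) 0 U := fun p hp => by
  let i : Fin m := ⟨0, by omega⟩
  let j : Fin m := ⟨1, by omega⟩
  have hij : i ≠ j := by simp [i, j]
  have h₀ := hQ.criterion_time_slopes hm hU hp (i := i) (u := 0) rfl
  have h₁ := hQ.criterion_time_slopes hm hU hp (i := i) (u := Pi.single j 1) (by simp [hij])
  rw [map_zero] at h₀
  rw [coupling_single (Or.inl rfl)] at h₁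
  have hfij : f i j ≠ 0 := left_ne_zero_of_mul (hf i j rfl).ne'
  have hX : dirDeriv (baseVec 1) (horizontal Q 1) p * f i j = 0 := by linarith
  exact (mul_eq_zero.1 hX).resolve_right hfij

end Stretch

section Rotation

variable {U : Set (PointSpace m)} {Q : VField m} {p : PointSpace m} {f : Fin m → Fin m → ℝ}
  {β : ℝ}

theorem dirDeriv_eq_sum_baseVec (v : PointSpace m) (g : PointSpace m → ℝ) :
    dirDeriv v g = v.1 0 • dirDeriv (baseVec 0) g + v.1 1 • dirDeriv (baseVec 1) g
      + v.1 2 • dirDeriv (baseVec 2) g + dirDeriv (0, v.2) g := by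
  have hv : v = v.1 0 • baseVec 0 + v.1 1 • baseVec 1 + v.1 2 • baseVec 2 + (0, v.2) := by
    ext x
    · fin_cases x <;> simp [baseVec]
    · simp [baseVec]
  simp only [← dirDeriv_smul_dir, ← dirDeriv_add_dir, ← hv]

/-- The angular velocity `ξʸ_x` with which a vector field rotates the `(x, y)`-plane. -/
def angularVelocity (Q : VField m) : PointSpace m → ℝ := dirDeriv (baseVec 1) (horizontal Q 2)

theorem contDiffOn_angularVelocity (hU : IsOpen U) (hQ : ContDiffOn ℝ ∞ Q U) :
    ContDiffOn ℝ ∞ (angularVelocity Q) U :=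
  contDiffOn_dirDeriv hU (contDiffOn_horizontal hQ 2) (baseVec 1)

/-- The first-order determining equations on `U`, together with `ξˣ_x = 0`: at each instant the
vector field `ξˣ ∂_x + ξʸ ∂_y` then generates rigid motions of the `(x, y)`-plane. -/
structure RigidDeterminingEquations (U : Set (PointSpace m)) (Q : VField m) : Prop where
  contDiffOn : ContDiffOn ℝ ∞ Q U
  firstOrder : ∀ p ∈ U, FirstOrderDeterminingEquations Q p
  xiX_x : Set.EqOn (dirDeriv (baseVec 1) (horizontal Q 1)) 0 U

theorem IsLieSymmetryOn.rigidDeterminingEquations (hm : 2 ≤ m) (hU : IsOpen U)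
    (hf : ∀ i j : Fin m, i.val + 1 = j.val → 0 < f i j * f j i)
    (hQ : IsLieSymmetryOn f β U Q) : RigidDeterminingEquations U Q where
  contDiffOn := hQ.1
  firstOrder _ hp := hQ.firstOrderDeterminingEquations hm hU hp
  xiX_x := hQ.xiX_x_eq_zero hm hU hf

namespace RigidDeterminingEquations

theorem xiY_y (h : RigidDeterminingEquations U Q) :
    Set.EqOn (dirDeriv (baseVec 2) (horizontal Q 2)) 0 U := fun p hp =>
  (h.firstOrder p hp).xiY_y.trans (h.xiX_x hp)

theorem xiX_y (h : RigidDeterminingEquations U Q) :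
    Set.EqOn (dirDeriv (baseVec 2) (horizontal Q 1)) (-angularVelocity Q) U := fun p hp =>
  (h.firstOrder p hp).xiX_y

theorem dirDeriv_spatial_tau (h : RigidDeterminingEquations U Q) {v : PointSpace m}
    (hv : v.1 0 = 0) : Set.EqOn (dirDeriv v (horizontal Q 0)) 0 U := fun p hp => by
  have hp₁ := h.firstOrder p hp
  simp [dirDeriv_eq_sum_baseVec v, hv, hp₁.tau_x, hp₁.tau_y, hp₁.fibre_horizontal]

theorem dirDeriv_spatial_angularVelocity (h : RigidDeterminingEquations U Q) (hU : IsOpen U)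
    {v : PointSpace m} (hv : v.1 0 = 0) : Set.EqOn (dirDeriv v (angularVelocity Q)) 0 U := by
  have hξ := contDiffOn_horizontal h.contDiffOn
  have hx : Set.EqOn (dirDeriv (baseVec 1) (angularVelocity Q)) 0 U := fun p hp => by
    have hyx := eqOn_dirDeriv_dirDeriv_zero hU (hξ 1) h.xiX_x (baseVec 2)
    have hxy := eqOn_dirDeriv hU h.xiX_y (baseVec 1)
    rw [dirDeriv_neg] at hxy
    exact neg_eq_zero.1 ((hxy hp).symm.trans (hyx hp))
  have hy := eqOn_dirDeriv_dirDeriv_zero hU (hξ 2) h.xiY_y (baseVec 1)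
  have hψ := eqOn_dirDeriv_dirDeriv_zero hU (hξ 2)
    (fun p hp => (h.firstOrder p hp).fibre_horizontal v.2 2) (baseVec 1)
  intro p hp
  have hy' : dirDeriv (baseVec 2) (angularVelocity Q) p = 0 := hy hp
  have hψ' : dirDeriv (0, v.2) (angularVelocity Q) p = 0 := hψ hp
  have hx' : dirDeriv (baseVec 1) (angularVelocity Q) p = 0 := hx hp
  simp [dirDeriv_eq_sum_baseVec v, hv, hx', hy', hψ']

theorem dirDeriv_slopeVec_one_frozenCharacteristic (h : RigidDeterminingEquations U Q)
    (hU : IsOpen U) (a : Fin m → Fin 3 → ℝ) (i : Fin m) :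
    Set.EqOn (dirDeriv (slopeVec a 1) (frozenCharacteristic Q i (a i)))
      (dirDeriv (baseVec 0) (horizontal Q 2)
        - (a i 1 • dirDeriv (baseVec 0) (horizontal Q 0) + a i 2 • angularVelocity Q)) U :=
  fun p hp => by
    have hp₁ := h.firstOrder p hp
    have hx : dirDeriv (baseVec 1) (horizontal Q 1) p = 0 := h.xiX_x hp
    simp only [hp₁.dirDeriv_slopeVec_frozenCharacteristic hU h.contDiffOn hp, hp₁.eta_x, hx,
      hp₁.tau_x, Fin.sum_univ_three, Pi.sub_apply, Pi.add_apply, Pi.smul_apply, smul_eq_mul,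
      angularVelocity]
    ring

theorem dirDeriv_slopeVec_two_frozenCharacteristic (h : RigidDeterminingEquations U Q)
    (hU : IsOpen U) (a : Fin m → Fin 3 → ℝ) (i : Fin m) :
    Set.EqOn (dirDeriv (slopeVec a 2) (frozenCharacteristic Q i (a i)))
      (-dirDeriv (baseVec 0) (horizontal Q 1)
        - (a i 2 • dirDeriv (baseVec 0) (horizontal Q 0) + (-a i 1) • angularVelocity Q)) U :=
  fun p hp => by
    have hp₁ := h.firstOrder p hp
    have hx : dirDeriv (baseVec 1) (horizontal Q 1) p = 0 := h.xiX_x hp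
    simp only [hp₁.dirDeriv_slopeVec_frozenCharacteristic hU h.contDiffOn hp, hp₁.eta_y,
      hp₁.xiX_y, hp₁.xiY_y, hx, hp₁.tau_y, Fin.sum_univ_three, Pi.sub_apply, Pi.add_apply,
      Pi.neg_apply, Pi.smul_apply, smul_eq_mul, angularVelocity]
    ring

theorem dirDeriv_spatial_sub (h : RigidDeterminingEquations U Q) (hU : IsOpen U)
    {v : PointSpace m} (hv : v.1 0 = 0) {g : PointSpace m → ℝ} (hg : ContDiffOn ℝ ∞ g U)
    (r s : ℝ) :
    Set.EqOn (dirDeriv v (g - (r • dirDeriv (baseVec 0) (horizontal Q 0)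
      + s • angularVelocity Q))) (dirDeriv v g) U := fun p hp => by
  have hξ := contDiffOn_horizontal h.contDiffOn
  have hτ : dirDeriv v (dirDeriv (baseVec 0) (horizontal Q 0)) p = 0 :=
    eqOn_dirDeriv_dirDeriv_zero hU (hξ 0) (h.dirDeriv_spatial_tau hv) (baseVec 0) hp
  have hω : dirDeriv v (angularVelocity Q) p = 0 := h.dirDeriv_spatial_angularVelocity hU hv hp
  have hdiff := fun {g : PointSpace m → ℝ} (hg : ContDiffOn ℝ ∞ g U) =>
    differentiableAt_of_contDiffOn hU hg hp
  have hdτ := hdiff (contDiffOn_dirDeriv hU (hξ 0) (baseVec 0))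
  have hdω := hdiff (contDiffOn_angularVelocity hU h.contDiffOn)
  simp only [dirDeriv] at hτ hω ⊢
  rw [fderiv_sub (hdiff hg) ((hdτ.const_smul r).add (hdω.const_smul s)),
    fderiv_add (hdτ.const_smul r) (hdω.const_smul s), fderiv_const_smul hdτ,
    fderiv_const_smul hdω]
  simp [hτ, hω]

theorem dirDeriv_spatial_dirDeriv_slopeVec_one (h : RigidDeterminingEquations U Q)
    (hU : IsOpen U) (a : Fin m → Fin 3 → ℝ) (i : Fin m) {v : PointSpace m} (hv : v.1 0 = 0) :
    Set.EqOn (dirDeriv v (dirDeriv (slopeVec a 1) (frozenCharacteristic Q i (a i))))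
      (dirDeriv (baseVec 0) (dirDeriv v (horizontal Q 2))) U :=
  have hξ := contDiffOn_horizontal h.contDiffOn 2
  (eqOn_dirDeriv hU (h.dirDeriv_slopeVec_one_frozenCharacteristic hU a i) v).trans <|
    (h.dirDeriv_spatial_sub hU hv (contDiffOn_dirDeriv hU hξ _) _ _).trans <|
      dirDeriv_comm hU hξ v (baseVec 0)

theorem dirDeriv_spatial_dirDeriv_slopeVec_two (h : RigidDeterminingEquations U Q)
    (hU : IsOpen U) (a : Fin m → Fin 3 → ℝ) (i : Fin m) {v : PointSpace m} (hv : v.1 0 = 0) :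
    Set.EqOn (dirDeriv v (dirDeriv (slopeVec a 2) (frozenCharacteristic Q i (a i))))
      (-dirDeriv (baseVec 0) (dirDeriv v (horizontal Q 1))) U := by
  have hξ := contDiffOn_horizontal h.contDiffOn 1
  have hneg : ContDiffOn ℝ ∞ (-dirDeriv (baseVec 0) (horizontal Q 1)) U :=
    (contDiffOn_dirDeriv hU hξ _).neg
  refine (eqOn_dirDeriv hU (h.dirDeriv_slopeVec_two_frozenCharacteristic hU a i) v).trans <|
    (h.dirDeriv_spatial_sub hU hv hneg _ _).trans fun p hp => ?_
  rw [dirDeriv_neg, Pi.neg_apply, Pi.neg_apply, dirDeriv_comm hU hξ v (baseVec 0) hp]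

theorem eqOn_dirDeriv_slopeVec_horizontal (h : RigidDeterminingEquations U Q)
    {g : PointSpace m → ℝ} {k l : Fin 3}
    (hg : Set.EqOn (dirDeriv (baseVec k) (horizontal Q l)) g U) (a : Fin m → Fin 3 → ℝ) :
    Set.EqOn (dirDeriv (slopeVec a k) (horizontal Q l)) g U := fun q hq =>
  ((h.firstOrder q hq).dirDeriv_slopeVec_horizontal a k l).trans (hg hq)

theorem dirDeriv_slopeVec_one_one (h : RigidDeterminingEquations U Q) (hU : IsOpen U)
    (a : Fin m → Fin 3 → ℝ) (i : Fin m) :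
    Set.EqOn (dirDeriv (slopeVec a 1) (dirDeriv (slopeVec a 1) (frozenCharacteristic Q i (a i))))
      (dirDeriv (baseVec 0) (angularVelocity Q)) U :=
  (h.dirDeriv_spatial_dirDeriv_slopeVec_one hU a i (by simp [slopeVec])).trans
    (eqOn_dirDeriv hU (h.eqOn_dirDeriv_slopeVec_horizontal (fun _ _ => rfl) a) _)

theorem dirDeriv_slopeVec_one_two (h : RigidDeterminingEquations U Q) (hU : IsOpen U)
    (a : Fin m → Fin 3 → ℝ) (i : Fin m) :
    Set.EqOn (dirDeriv (slopeVec a 1) (dirDeriv (slopeVec a 2) (frozenCharacteristic Q i (a i))))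
      0 U :=
  (h.dirDeriv_spatial_dirDeriv_slopeVec_two hU a i (by simp [slopeVec])).trans fun q hq => by
    simp [eqOn_dirDeriv_zero hU (h.eqOn_dirDeriv_slopeVec_horizontal h.xiX_x a) _ hq]

theorem dirDeriv_slopeVec_two_two (h : RigidDeterminingEquations U Q) (hU : IsOpen U)
    (a : Fin m → Fin 3 → ℝ) (i : Fin m) :
    Set.EqOn (dirDeriv (slopeVec a 2) (dirDeriv (slopeVec a 2) (frozenCharacteristic Q i (a i))))
      (dirDeriv (baseVec 0) (angularVelocity Q)) U :=
  (h.dirDeriv_spatial_dirDeriv_slopeVec_two hU a i (by simp [slopeVec])).trans fun q hq => by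
    rw [Pi.neg_apply, eqOn_dirDeriv hU (h.eqOn_dirDeriv_slopeVec_horizontal h.xiX_y a) _ hq,
      dirDeriv_neg, Pi.neg_apply, neg_neg]

theorem vorticityTransport_thirdCoeffLower (h : RigidDeterminingEquations U Q) (hU : IsOpen U)
    (hp : p ∈ U) (a : Fin m → Fin 3 → ℝ) (i : Fin m) :
    vorticityTransport (a i) (thirdCoeffLower Q a p i)
      = 2 * dirDeriv (baseVec 0) (dirDeriv (baseVec 0) (angularVelocity Q)) p := by
  have h₁₁ := h.dirDeriv_slopeVec_one_one hU a i
  have h₁₂ := h.dirDeriv_slopeVec_one_two hU a i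
  have h₂₂ := h.dirDeriv_slopeVec_two_two hU a i
  have hω : ∀ v : PointSpace m, v.1 0 = 0 →
      dirDeriv v (dirDeriv (baseVec 0) (angularVelocity Q)) p = 0 := fun v hv =>
    eqOn_dirDeriv_dirDeriv_zero hU (contDiffOn_angularVelocity hU h.contDiffOn)
      (h.dirDeriv_spatial_angularVelocity hU hv) _ hp
  have hω₀ : dirDeriv (slopeVec a 0) (dirDeriv (baseVec 0) (angularVelocity Q)) p
      = dirDeriv (baseVec 0) (dirDeriv (baseVec 0) (angularVelocity Q)) p := by
    rw [slopeVec_eq, dirDeriv_add_dir, Pi.add_apply, hω (0, _) rfl, add_zero]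
  have hω₁ := hω (slopeVec a 1) (by simp [slopeVec])
  have hω₂ := hω (slopeVec a 2) (by simp [slopeVec])
  simp only [vorticityTransport, thirdCoeffLower, eqOn_dirDeriv hU h₁₁ _ hp,
    eqOn_dirDeriv hU h₂₂ _ hp, eqOn_dirDeriv_zero hU h₁₂ _ hp, hω₀, hω₁, hω₂, Pi.zero_apply]
  ring

end RigidDeterminingEquations

theorem IsLieSymmetryOn.criterion_uniform_slopes (hm : 2 ≤ m) (hU : IsOpen U)
    (hf : ∀ i j : Fin m, i.val + 1 = j.val → 0 < f i j * f j i)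
    (hQ : IsLieSymmetryOn f β U Q) (hp : p ∈ U) (b : Fin 3 → ℝ) (i : Fin m) :
    2 * dirDeriv (baseVec 0) (dirDeriv (baseVec 0) (angularVelocity Q)) p
      + coupling f i (fun j => dirDeriv (baseVec 0) (vertical Q j) p)
      + β * (dirDeriv (baseVec 0) (horizontal Q 2) p
        + b 1 * dirDeriv (baseVec 0) (horizontal Q 0) p - b 2 * angularVelocity Q p) = 0 := by
  have h := hQ.rigidDeterminingEquations hm hU hf
  have hφ₁ := fun j => h.dirDeriv_slopeVec_one_frozenCharacteristic hU (fun _ => b) j hp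
  have hφ₂ := fun j => h.dirDeriv_slopeVec_two_frozenCharacteristic hU (fun _ => b) j hp
  have hφ₀ := fun j => (h.firstOrder p hp).dirDeriv_slopeVec_frozenCharacteristic hU
    h.contDiffOn hp (fun _ => b) j 0
  have hcoupling := coupling_congr (f := f) (i := i)
    (u := fun j => dirDeriv (slopeVec (fun _ => b) 0) (frozenCharacteristic Q j b) p)
    (v := fun j => dirDeriv (baseVec 0) (vertical Q j) p) fun j => by rw [hφ₀, hφ₀]; ring
  have hcrit := hQ.criterionLower_add_eq_zero hm hU hp (fun _ => b) i
  have hthird : vorticityTransport b (thirdCoeffLower Q (fun _ => b) p i)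
      = 2 * dirDeriv (baseVec 0) (dirDeriv (baseVec 0) (angularVelocity Q)) p :=
    h.vorticityTransport_thirdCoeffLower hU hp (fun _ => b) i
  simp only [criterionLower, hthird, hcoupling, hφ₁, hφ₂, coupling_const, qgLower, Pi.sub_apply,
    Pi.add_apply, Pi.smul_apply, smul_eq_mul] at hcrit
  linear_combination hcrit

/-- The solved form of the determining equations: all first-order derivatives of the components are
expressed through the functions `ξˣ_t` and `ηⁱ_t`, and the latter agree for all layers. -/
structure SolvesDeterminingEquations (U : Set (PointSpace m)) (Q : VField m) : Prop where
  contDiffOn : ContDiffOn ℝ ∞ Q U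
  tau (v : PointSpace m) : Set.EqOn (dirDeriv v (horizontal Q 0)) 0 U
  xiX (v : PointSpace m) : Set.EqOn (dirDeriv v (horizontal Q 1))
    (v.1 0 • dirDeriv (baseVec 0) (horizontal Q 1)) U
  xiY (v : PointSpace m) : Set.EqOn (dirDeriv v (horizontal Q 2)) 0 U
  eta (v : PointSpace m) (i : Fin m) : Set.EqOn (dirDeriv v (vertical Q i))
    (v.1 0 • dirDeriv (baseVec 0) (vertical Q i)
      - v.1 2 • dirDeriv (baseVec 0) (horizontal Q 1)) U
  eta_t (i j : Fin m) : Set.EqOn (dirDeriv (baseVec 0) (vertical Q i))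
    (dirDeriv (baseVec 0) (vertical Q j)) U

theorem IsLieSymmetryOn.tau_t_eq_zero_and_angularVelocity_eq_zero (hm : 2 ≤ m) (hU : IsOpen U)
    (hf : ∀ i j : Fin m, i.val + 1 = j.val → 0 < f i j * f j i) (hβ : β ≠ 0)
    (hQ : IsLieSymmetryOn f β U Q) (hp : p ∈ U) :
    dirDeriv (baseVec 0) (horizontal Q 0) p = 0 ∧ angularVelocity Q p = 0 := by
  have h := fun b => hQ.criterion_uniform_slopes hm hU hf hp b ⟨0, by omega⟩
  have h₀ := h 0
  have hτ := h (Pi.single 1 1)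
  have hω := h (Pi.single 2 1)
  simp +decide only [Pi.zero_apply, Pi.single_apply, if_true, if_false] at h₀ hτ hω
  exact ⟨mul_left_cancel₀ hβ (by linarith), mul_left_cancel₀ hβ (by linarith)⟩

theorem IsLieSymmetryOn.xiY_t_eq_zero_and_eta_t_eq (hm : 2 ≤ m) (hU : IsOpen U)
    (hf : ∀ i j : Fin m, i.val + 1 = j.val → 0 < f i j * f j i) (hβ : β ≠ 0)
    (hQ : IsLieSymmetryOn f β U Q) (hp : p ∈ U) :
    dirDeriv (baseVec 0) (horizontal Q 2) p = 0 ∧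
      ∀ i j, dirDeriv (baseVec 0) (vertical Q i) p = dirDeriv (baseVec 0) (vertical Q j) p := by
  have hω : Set.EqOn (angularVelocity Q) 0 U := fun q hq =>
    (hQ.tau_t_eq_zero_and_angularVelocity_eq_zero hm hU hf hβ hq).2
  have hω_tt := eqOn_dirDeriv_zero hU (eqOn_dirDeriv_zero hU hω (baseVec 0)) (baseVec 0) hp
  have hcoupling : ∀ i, coupling f i (fun j => dirDeriv (baseVec 0) (vertical Q j) p)
      = -(β * dirDeriv (baseVec 0) (horizontal Q 2) p) := fun i => by
    have h := hQ.criterion_uniform_slopes hm hU hf hp 0 i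
    simp only [hω_tt, Pi.zero_apply] at h
    linear_combination h
  obtain ⟨hξ, hη⟩ := eq_zero_and_eq_of_coupling_eq_const (by omega) hf hcoupling
  exact ⟨(mul_eq_zero.1 (neg_eq_zero.1 hξ)).resolve_left hβ, hη⟩

theorem IsLieSymmetryOn.solvesDeterminingEquations (hm : 2 ≤ m) (hU : IsOpen U)
    (hf : ∀ i j : Fin m, i.val + 1 = j.val → 0 < f i j * f j i) (hβ : β ≠ 0)
    (hQ : IsLieSymmetryOn f β U Q) : SolvesDeterminingEquations U Q := by
  have h := hQ.rigidDeterminingEquations hm hU hf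
  have hτ_t := fun p hp => (hQ.tau_t_eq_zero_and_angularVelocity_eq_zero (p := p) hm hU hf hβ hp).1
  have hξY_x : ∀ p ∈ U, dirDeriv (baseVec 1) (horizontal Q 2) p = 0 := fun p hp =>
    (hQ.tau_t_eq_zero_and_angularVelocity_eq_zero hm hU hf hβ hp).2
  have hξY_t := fun p hp => (hQ.xiY_t_eq_zero_and_eta_t_eq (p := p) hm hU hf hβ hp).1
  refine ⟨hQ.1, fun v p hp => ?_, fun v p hp => ?_, fun v p hp => ?_, fun v i p hp => ?_,
    fun i j p hp => (hQ.xiY_t_eq_zero_and_eta_t_eq hm hU hf hβ hp).2 i j⟩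
  all_goals
    have h₁ := h.firstOrder p hp
    have hξX_x := h.xiX_x hp
    rw [dirDeriv_eq_sum_baseVec v]
  · simp [hτ_t p hp, h₁.tau_x, h₁.tau_y, h₁.fibre_horizontal]
  · simp [hξX_x, h₁.xiX_y, hξY_x p hp, h₁.fibre_horizontal]
  · simp [hξY_t p hp, hξY_x p hp, h₁.xiY_y, hξX_x, h₁.fibre_horizontal]
  · have hfibre : dirDeriv (0, v.2) (vertical Q i) p = 0 := by
      rw [h₁.dirDeriv_fibre_vertical, hξX_x, hτ_t p hp]
      simp
    simp [hfibre, h₁.eta_x, h₁.eta_y, hξY_t p hp, sub_eq_add_neg]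

end Rotation

section Converse

variable {U : Set (PointSpace m)} {Q : VField m} {g : PointSpace m → ℝ} {z : JetSpace m}
  {f : Fin m → Fin m → ℝ} {β : ℝ}

theorem totalTwo_eq_zero (hU : IsOpen U) (hg : ContDiffOn ℝ ∞ g U) {c : Fin 3}
    (h : Set.EqOn (totalOne g c) 0 (toPoint ⁻¹' U)) (b : Fin 3) :
    Set.EqOn (totalTwo g b c) 0 (toPoint ⁻¹' U) := fun z hz => by
  rw [← totalDeriv_eq_of_hasLineDerivAt (hasLineDerivAt_totalOne hU hg hz b c),
    eqOn_totalDeriv hU h b hz]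
  exact totalDeriv_eq_of_hasLineDerivAt (hasDerivAt_const _ _)

theorem totalThree_eq_zero (hU : IsOpen U) (hg : ContDiffOn ℝ ∞ g U) {b c : Fin 3}
    (h : Set.EqOn (totalTwo g b c) 0 (toPoint ⁻¹' U)) (a : Fin 3) :
    Set.EqOn (totalThree g a b c) 0 (toPoint ⁻¹' U) := fun z hz => by
  rw [← totalDeriv_eq_of_hasLineDerivAt (hasLineDerivAt_totalTwo hU hg hz a b c),
    eqOn_totalDeriv hU h a hz]
  exact totalDeriv_eq_of_hasLineDerivAt (hasDerivAt_const _ _)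

namespace SolvesDeterminingEquations

theorem totalOne_horizontal (h : SolvesDeterminingEquations U Q) (hz : toPoint z ∈ U)
    (k a : Fin 3) : totalOne (horizontal Q k) a z = (Pi.single a 1 : Fin 3 → ℝ) 0
      * (Pi.single k 1 : Fin 3 → ℝ) 1 * dirDeriv (baseVec 0) (horizontal Q 1) (toPoint z) := by
  have hτ : totalOne (horizontal Q 0) a z = 0 := h.tau (tangentVec a z) hz
  have hξY : totalOne (horizontal Q 2) a z = 0 := h.xiY (tangentVec a z) hz
  have hξX : totalOne (horizontal Q 1) a z = (Pi.single a 1 : Fin 3 → ℝ) 0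
      * dirDeriv (baseVec 0) (horizontal Q 1) (toPoint z) := h.xiX (tangentVec a z) hz
  fin_cases k <;> simp [hτ, hξX, hξY]

theorem totalOne_vertical (h : SolvesDeterminingEquations U Q) (hz : toPoint z ∈ U)
    (i : Fin m) (a : Fin 3) : totalOne (vertical Q i) a z
      = (Pi.single a 1 : Fin 3 → ℝ) 0 * dirDeriv (baseVec 0) (vertical Q i) (toPoint z)
        - (Pi.single a 1 : Fin 3 → ℝ) 2
          * dirDeriv (baseVec 0) (horizontal Q 1) (toPoint z) :=
  h.eta (tangentVec a z) i hz

theorem totalTwo_horizontal (h : SolvesDeterminingEquations U Q) (hU : IsOpen U)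
    (hz : toPoint z ∈ U) (k b : Fin 3) {c : Fin 3} (hc : c ≠ 0) :
    totalTwo (horizontal Q k) b c z = 0 :=
  totalTwo_eq_zero hU (contDiffOn_horizontal h.contDiffOn k) (fun z hz => by
    simp [h.totalOne_horizontal hz, hc.symm]) b hz

theorem totalTwo_vertical (h : SolvesDeterminingEquations U Q) (hU : IsOpen U)
    (hz : toPoint z ∈ U) (i : Fin m) {b c : Fin 3} (hb : b ≠ 0) (hc : c ≠ 0) :
    totalTwo (vertical Q i) b c z = 0 := by
  let ξ_t := dirDeriv (baseVec 0) (horizontal Q 1)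
  have hξ := contDiffOn_horizontal h.contDiffOn 1
  have hηc : Set.EqOn (totalOne (vertical Q i) c)
      (fun z => -(Pi.single c 1 : Fin 3 → ℝ) 2 * ξ_t (toPoint z)) (toPoint ⁻¹' U) := fun z hz => by
    simp [h.totalOne_vertical hz, hc.symm, ξ_t]
  have hξ_tb : totalOne ξ_t b z = 0 :=
    eqOn_dirDeriv_dirDeriv_zero hU hξ ((h.xiX (tangentVec b z)).trans fun p _ => by
      simp [tangentVec, hb.symm]) (baseVec 0) hz
  rw [← totalDeriv_eq_of_hasLineDerivAt
      (hasLineDerivAt_totalOne hU (contDiffOn_vertical h.contDiffOn i) hz b c),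
    eqOn_totalDeriv hU hηc b hz]
  refine totalDeriv_eq_of_hasLineDerivAt (HasDerivAt.congr_deriv (HasDerivAt.const_mul _
    (hasLineDerivAt_comp_totalOne hU (contDiffOn_dirDeriv hU hξ (baseVec 0)) hz b)) ?_)
  rw [hξ_tb, mul_zero]

theorem prolongation_idx (h : SolvesDeterminingEquations U Q) (hU : IsOpen U)
    (hz : toPoint z ∈ U) (i : Fin m) (a : Fin 3) :
    (prolongation Q z).2 i (idx a) = (Pi.single a 1 : Fin 3 → ℝ) 0
        * (dirDeriv (baseVec 0) (vertical Q i) (toPoint z)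
          - dirDeriv (baseVec 0) (horizontal Q 1) (toPoint z) * z.2 i (idx 1))
      - (Pi.single a 1 : Fin 3 → ℝ) 2
        * dirDeriv (baseVec 0) (horizontal Q 1) (toPoint z) := by
  simp only [MultiLayerQG.prolongation_idx hU h.contDiffOn hz, h.totalOne_horizontal hz,
    h.totalOne_vertical hz, Fin.sum_univ_three, Pi.single_eq_same, Pi.single_eq_of_ne,
    ne_eq, one_ne_zero, Fin.reduceEq, not_false_eq_true]
  ring

theorem prolongation_idx_add_idx_add_idx (h : SolvesDeterminingEquations U Q) (hU : IsOpen U)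
    (hz : toPoint z ∈ U) (i : Fin m) {a b c : Fin 3} (hab : a ≤ b) (hbc : b ≤ c) (hb : b ≠ 0)
    (hc : c ≠ 0) :
    (prolongation Q z).2 i (idx a + idx b + idx c) = -((Pi.single a 1 : Fin 3 → ℝ) 0
      * dirDeriv (baseVec 0) (horizontal Q 1) (toPoint z) * z.2 i (idx 1 + idx b + idx c)) := by
  have hξ := fun k => contDiffOn_horizontal h.contDiffOn k
  have hη₃ := totalThree_eq_zero hU (contDiffOn_vertical h.contDiffOn i)
    (fun z hz => h.totalTwo_vertical hU hz i hb hc) a hz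
  have hξ₃ := fun k => totalThree_eq_zero hU (hξ k)
    (fun z hz => h.totalTwo_horizontal hU hz k b hc) a hz
  rw [MultiLayerQG.prolongation_idx_add_idx_add_idx hU h.contDiffOn hz i hab hbc]
  simp [hη₃, hξ₃, h.totalTwo_horizontal hU hz, h.totalOne_horizontal hz, hb, hc, hb.symm,
    hc.symm, Fin.sum_univ_three]

theorem isLieSymmetryOn (h : SolvesDeterminingEquations U Q) (hU : IsOpen U) :
    IsLieSymmetryOn f β U Q := by
  refine ⟨h.contDiffOn, fun z hz _ i => ?_⟩
  let ξ_t := dirDeriv (baseVec 0) (horizontal Q 1) (toPoint z)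
  have hone := h.prolongation_idx hU hz
  have hthree := fun {a b c : Fin 3} => h.prolongation_idx_add_idx_add_idx (a := a) (b := b)
    (c := c) hU hz i
  have htime : coupling f i (fun j => (prolongation Q z).2 j (idx 0))
      = -(ξ_t * coupling f i fun j => z.2 j (idx 1)) := by
    rw [coupling_congr (v := -ξ_t • fun j => z.2 j (idx 1)) fun j => ?_, map_smul, smul_eq_mul,
      neg_mul]
    simp only [hone, h.eta_t j i hz, Pi.single_eq_same, Pi.smul_apply, smul_eq_mul, ξ_t]
    ring
  have hx : coupling f i (fun j => (prolongation Q z).2 j (idx 1)) = 0 := by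
    simpa [hone] using coupling_const f i 0
  have hy : coupling f i (fun j => (prolongation Q z).2 j (idx 2)) = 0 := by
    simpa [hone] using coupling_const f i (-ξ_t)
  rw [lineDeriv_qgEquation, htime, hx, hy, hthree (by decide) (by decide) (by decide) (by decide),
    hthree (by decide) (by decide) (by decide) (by decide),
    hthree (by decide) (by decide) (by decide) (by decide),
    hthree (by decide) (by decide) (by decide) (by decide),
    hthree (by decide) (by decide) (by decide) (by decide),
    hthree (by decide) (by decide) (by decide) (by decide)]
  simp only [hone, Pi.single_eq_same, Pi.single_eq_of_ne, ne_eq, zero_ne_one, Fin.reduceEq,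
    not_false_eq_true, ξ_t]
  ring

end SolvesDeterminingEquations

end Converse

section GeneralElement

variable {U : Set (PointSpace m)} {Q : VField m} {p : PointSpace m} {γ b : ℝ} {c : Fin m → ℝ}
  {χ κ : ℝ → ℝ}

/-- The linear combination of the spanning fields in which `∂_t`, `∂_y` and `∂_{ψⁱ}` have the
coefficients `γ`, `b` and `c i`. -/
def generalField (γ b : ℝ) (c : Fin m → ℝ) (χ κ : ℝ → ℝ) : VField m := fun p =>
  (![γ, χ (p.1 0), b], fun i => c i - p.1 2 * deriv χ (p.1 0) + κ (p.1 0))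

/-- `Q` coincides on `U` with a linear combination of the spanning fields, written out in
components. -/
def IsGeneralElementOn (U : Set (PointSpace m)) (Q : VField m) : Prop :=
  ∃ (γ b : ℝ) (c : Fin m → ℝ) (χ κ : ℝ → ℝ), ContDiffOn ℝ ∞ χ (timeRange U) ∧
    ContDiffOn ℝ ∞ κ (timeRange U) ∧ Set.EqOn Q (generalField γ b c χ κ) U

/-- The independent variable `k` as a linear functional. -/
def coord (k : Fin 3) : PointSpace m →L[ℝ] ℝ :=
  .proj (φ := fun _ => ℝ) k ∘L .fst ℝ _ _

@[simp]
theorem coord_apply (k : Fin 3) (p : PointSpace m) : coord k p = p.1 k := rfl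

theorem mapsTo_timeRange : Set.MapsTo (fun p : PointSpace m => p.1 0) U (timeRange U) :=
  Set.mapsTo_image _ _

theorem isOpen_timeRange (hU : IsOpen U) : IsOpen (timeRange U) :=
  ((isOpenMap_eval 0).comp isOpenMap_fst) U hU

theorem contDiffOn_deriv_timeRange (hU : IsOpen U) (hχ : ContDiffOn ℝ ∞ χ (timeRange U)) :
    ContDiffOn ℝ ∞ (deriv χ) (timeRange U) :=
  hχ.deriv_of_isOpen (isOpen_timeRange hU) (by simp)

theorem contDiffOn_comp_time (hχ : ContDiffOn ℝ ∞ χ (timeRange U)) :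
    ContDiffOn ℝ ∞ (fun p : PointSpace m => χ (p.1 0)) U :=
  hχ.comp (coord 0).contDiff.contDiffOn mapsTo_timeRange

theorem hasDerivAt_timeRange (hU : IsOpen U) (hχ : ContDiffOn ℝ ∞ χ (timeRange U)) (hp : p ∈ U) :
    HasDerivAt χ (deriv χ (p.1 0)) (p.1 0) :=
  (differentiableAt_of_contDiffOn (isOpen_timeRange hU) hχ (mapsTo_timeRange hp)).hasDerivAt

theorem hasFDerivAt_comp_time (hU : IsOpen U) (hχ : ContDiffOn ℝ ∞ χ (timeRange U)) (hp : p ∈ U) :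
    HasFDerivAt (fun p : PointSpace m => χ (p.1 0)) (deriv χ (p.1 0) • coord 0) p :=
  (hasDerivAt_timeRange hU hχ hp).comp_hasFDerivAt p (coord 0).hasFDerivAt

theorem contDiffOn_mul_deriv (hU : IsOpen U) (hχ : ContDiffOn ℝ ∞ χ (timeRange U)) :
    ContDiffOn ℝ ∞ (fun p : PointSpace m => p.1 2 * deriv χ (p.1 0)) U :=
  (coord 2).contDiff.contDiffOn.mul (contDiffOn_comp_time (contDiffOn_deriv_timeRange hU hχ))

theorem hasFDerivAt_mul_deriv (hU : IsOpen U) (hχ : ContDiffOn ℝ ∞ χ (timeRange U)) (hp : p ∈ U) :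
    HasFDerivAt (fun p : PointSpace m => p.1 2 * deriv χ (p.1 0))
      (p.1 2 • deriv (deriv χ) (p.1 0) • coord 0 + deriv χ (p.1 0) • coord 2) p :=
  (coord 2).hasFDerivAt.mul
    (hasFDerivAt_comp_time hU (contDiffOn_deriv_timeRange hU hχ) hp)

theorem contDiffOn_generalField (hU : IsOpen U) (hχ : ContDiffOn ℝ ∞ χ (timeRange U))
    (hκ : ContDiffOn ℝ ∞ κ (timeRange U)) : ContDiffOn ℝ ∞ (generalField γ b c χ κ) U := by
  refine ContDiffOn.prodMk (contDiffOn_pi.2 fun k => ?_) (contDiffOn_pi.2 fun i => ?_)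
  · fin_cases k
    exacts [contDiffOn_const, contDiffOn_comp_time hχ, contDiffOn_const]
  · exact (contDiffOn_const.sub (contDiffOn_mul_deriv hU hχ)).add (contDiffOn_comp_time hκ)

theorem dirDeriv_generalField (hU : IsOpen U) (hχ : ContDiffOn ℝ ∞ χ (timeRange U))
    (hκ : ContDiffOn ℝ ∞ κ (timeRange U)) (v : PointSpace m) (hp : p ∈ U) :
    dirDeriv v (generalField γ b c χ κ) p = (Pi.single 1 (v.1 0 * deriv χ (p.1 0)), fun _ =>
      v.1 0 * (deriv κ (p.1 0) - p.1 2 * deriv (deriv χ) (p.1 0)) - v.1 2 * deriv χ (p.1 0)) := by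
  have hG := contDiffOn_generalField (γ := γ) (b := b) (c := c) hU hχ hκ
  refine Prod.ext (funext fun k => (dirDeriv_horizontal hU hG v k hp).symm.trans ?_)
    (funext fun i => (dirDeriv_vertical hU hG v i hp).symm.trans ?_)
  · fin_cases k
    · exact dirDeriv_of_hasFDerivAt (hasFDerivAt_const γ p) v
    · exact (dirDeriv_of_hasFDerivAt (hasFDerivAt_comp_time hU hχ hp) v).trans (mul_comm _ _)
    · exact dirDeriv_of_hasFDerivAt (hasFDerivAt_const b p) v
  · refine (dirDeriv_of_hasFDerivAt (((hasFDerivAt_mul_deriv hU hχ hp).const_sub (c i)).add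
      (hasFDerivAt_comp_time hU hκ hp)) v).trans ?_
    simp only [add_apply, neg_apply, smul_apply, coord_apply, smul_eq_mul]
    ring

theorem IsGeneralElementOn.solvesDeterminingEquations (hU : IsOpen U)
    (hQ : IsGeneralElementOn U Q) : SolvesDeterminingEquations U Q := by
  obtain ⟨γ, b, c, χ, κ, hχ, hκ, hQ⟩ := hQ
  have hsmooth := (contDiffOn_generalField hU hχ hκ).congr hQ
  have hD := fun v {p} (hp : p ∈ U) =>
    (eqOn_dirDeriv hU hQ v hp).trans (dirDeriv_generalField hU hχ hκ v hp)
  refine ⟨hsmooth, fun v p hp => ?_, fun v p hp => ?_, fun v p hp => ?_, fun v i p hp => ?_,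
    fun i j p hp => ?_⟩
  all_goals simp [dirDeriv_horizontal hU hsmooth _ _ hp, dirDeriv_vertical hU hsmooth _ _ hp,
    horizontal, vertical, hD _ hp, baseVec]

theorem exists_eqOn_const (hU : IsOpen U) (hUc : Convex ℝ U) {g : PointSpace m → ℝ}
    (hg : ContDiffOn ℝ ∞ g U) (h : ∀ v, Set.EqOn (dirDeriv v g) 0 U) : ∃ a, ∀ p ∈ U, g p = a :=
  hU.exists_is_const_of_fderiv_eq_zero hUc.isPreconnected
    (fun _ hp => (differentiableAt_of_contDiffOn hU hg hp).differentiableWithinAt)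
    fun _ hp => ContinuousLinearMap.ext fun v => h v hp

theorem exists_eqOn_comp_time (hU : IsOpen U) (hUc : Convex ℝ U) {g : PointSpace m → ℝ}
    (hg : ContDiffOn ℝ ∞ g U) (h : ∀ p ∈ U, ∀ v : PointSpace m, v.1 0 = 0 → dirDeriv v g p = 0) :
    ∃ χ : ℝ → ℝ, ContDiffOn ℝ ∞ χ (timeRange U) ∧ ∀ p ∈ U, g p = χ (p.1 0) :=
  exists_eqOn_comp_of_fderiv_ker hU hUc hg (coord 0) (e := baseVec 0) (by simp [baseVec]) h

namespace SolvesDeterminingEquations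

theorem exists_horizontal_eq (h : SolvesDeterminingEquations U Q) (hU : IsOpen U)
    (hUc : Convex ℝ U) : ∃ (γ b : ℝ) (χ : ℝ → ℝ), ContDiffOn ℝ ∞ χ (timeRange U) ∧
      ∀ p ∈ U, (Q p).1 = ![γ, χ (p.1 0), b] := by
  have hsmooth := contDiffOn_horizontal h.contDiffOn
  obtain ⟨γ, hγ⟩ := exists_eqOn_const hU hUc (hsmooth 0) h.tau
  obtain ⟨b, hb⟩ := exists_eqOn_const hU hUc (hsmooth 2) h.xiY
  obtain ⟨χ, hχ, hQχ⟩ := exists_eqOn_comp_time hU hUc (hsmooth 1) fun p hp v hv => by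
    simp [h.xiX v hp, hv]
  refine ⟨γ, b, χ, hχ, fun p hp => funext fun k => ?_⟩
  fin_cases k
  exacts [hγ p hp, hQχ p hp, hb p hp]

theorem fderiv_vertical (h : SolvesDeterminingEquations U Q) (i j : Fin m) :
    Set.EqOn (fderiv ℝ (vertical Q i)) (fderiv ℝ (vertical Q j)) U := fun p hp =>
  ContinuousLinearMap.ext fun v => by
    have hi := h.eta v i hp
    have hj := h.eta v j hp
    simp only [Pi.sub_apply, Pi.smul_apply, h.eta_t i j hp] at hi hj
    exact hi.trans hj.symm

theorem exists_vertical_eq (h : SolvesDeterminingEquations U Q) (hU : IsOpen U)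
    (hUc : Convex ℝ U) (i : Fin m) (hχ : ContDiffOn ℝ ∞ χ (timeRange U))
    (hQχ : ∀ p ∈ U, horizontal Q 1 p = χ (p.1 0)) :
    ∃ κ : ℝ → ℝ, ContDiffOn ℝ ∞ κ (timeRange U) ∧
      ∀ p ∈ U, vertical Q i p + p.1 2 * deriv χ (p.1 0) = κ (p.1 0) := by
  have hη := contDiffOn_vertical h.contDiffOn i
  refine exists_eqOn_comp_time hU hUc (hη.add (contDiffOn_mul_deriv hU hχ)) fun p hp v hv => ?_
  have hξ_t : dirDeriv (baseVec 0) (horizontal Q 1) p = deriv χ (p.1 0) :=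
    (eqOn_dirDeriv hU hQχ (baseVec 0) hp).trans (by
      simp [dirDeriv_of_hasFDerivAt (hasFDerivAt_comp_time hU hχ hp), baseVec])
  have hη_v : fderiv ℝ (vertical Q i) p v = -(v.1 2 * deriv χ (p.1 0)) :=
    (h.eta v i hp).trans (by simp [hv, hξ_t])
  refine (dirDeriv_of_hasFDerivAt ((differentiableAt_of_contDiffOn hU hη hp).hasFDerivAt.add
    (hasFDerivAt_mul_deriv hU hχ hp)) v).trans ?_
  simp [hη_v, hv, mul_comm]

theorem isGeneralElementOn (h : SolvesDeterminingEquations U Q) (hU : IsOpen U)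
    (hUc : Convex ℝ U) (hm : 0 < m) : IsGeneralElementOn U Q := by
  obtain ⟨γ, b, χ, hχ, hhor⟩ := h.exists_horizontal_eq hU hUc
  obtain ⟨κ, hκ, hver⟩ := h.exists_vertical_eq hU hUc ⟨0, hm⟩ hχ fun p hp =>
    congr_fun (hhor p hp) 1
  have hdiff : ∀ i, DifferentiableOn ℝ (vertical Q i) U := fun i p hp =>
    (differentiableAt_of_contDiffOn hU (contDiffOn_vertical h.contDiffOn i)
      hp).differentiableWithinAt
  choose c hc using fun i => hU.exists_eq_add_of_fderiv_eq hUc.isPreconnected (hdiff i)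
    (hdiff ⟨0, hm⟩) (h.fderiv_vertical i ⟨0, hm⟩)
  refine ⟨γ, b, c, χ, κ, hχ, hκ, fun p hp => Prod.ext (hhor p hp) (funext fun i => ?_)⟩
  simp only [generalField, ← hver p hp]
  refine (hc i hp).trans ?_
  ring

end SolvesDeterminingEquations

end GeneralElement

section Span

variable {U : Set (PointSpace m)} {Q Q₁ Q₂ : VField m} {γ b : ℝ} {c : Fin m → ℝ} {χ κ : ℝ → ℝ}

theorem fieldPt_eq_generalField : (fieldPt : VField m) = generalField 1 0 0 0 0 := by
  ext p k
  · fin_cases k <;> simp [fieldPt, generalField]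
  · simp [fieldPt, generalField, Pi.zero_def]

theorem fieldPy_eq_generalField : (fieldPy : VField m) = generalField 0 1 0 0 0 := by
  ext p k
  · fin_cases k <;> simp [fieldPy, generalField]
  · simp [fieldPy, generalField, Pi.zero_def]

theorem fieldPx_eq_generalField (χ : ℝ → ℝ) :
    (fieldPx χ : VField m) = generalField 0 0 0 χ 0 := by
  ext p k
  · fin_cases k <;> simp [fieldPx, generalField]
  · simp [fieldPx, generalField]

theorem fieldJ_eq_generalField (i : Fin m) :
    fieldJ i = generalField 0 0 (Pi.single i 1) 0 0 := by
  ext p k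
  · fin_cases k <;> simp [fieldJ, generalField]
  · simp [fieldJ, generalField, Pi.zero_def]

theorem fieldZ_eq_generalField (κ : ℝ → ℝ) :
    (fieldZ κ : VField m) = generalField 0 0 0 0 κ := by
  ext p k
  · fin_cases k <;> simp [fieldZ, generalField]
  · simp [fieldZ, generalField, Pi.zero_def]

theorem generalField_eq_sum (γ b : ℝ) (c : Fin m → ℝ) (χ κ : ℝ → ℝ) : generalField γ b c χ κ
    = γ • fieldPt + b • fieldPy + fieldPx χ + ∑ i, c i • fieldJ i + fieldZ κ := by
  ext p k
  · fin_cases k <;>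
      simp [generalField, fieldPt, fieldPy, fieldPx, fieldJ, fieldZ, Prod.fst_sum]
  · simp [generalField, fieldPt, fieldPy, fieldPx, fieldJ, fieldZ, Prod.snd_sum,
      Finset.sum_apply, Pi.single_apply, sub_eq_neg_add]

theorem isGeneralElementOn_of_mem_spanningFields (hQ : Q ∈ spanningFields U) :
    IsGeneralElementOn U Q := by
  rcases hQ with ((((rfl | rfl) | ⟨χ, hχ, rfl⟩) | ⟨i, rfl⟩) | ⟨κ, hκ, rfl⟩)
  · exact ⟨1, 0, 0, 0, 0, contDiffOn_const, contDiffOn_const, fun _ _ =>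
      congr_fun fieldPt_eq_generalField _⟩
  · exact ⟨0, 1, 0, 0, 0, contDiffOn_const, contDiffOn_const, fun _ _ =>
      congr_fun fieldPy_eq_generalField _⟩
  · exact ⟨0, 0, 0, χ, 0, hχ, contDiffOn_const, fun _ _ =>
      congr_fun (fieldPx_eq_generalField χ) _⟩
  · exact ⟨0, 0, Pi.single i 1, 0, 0, contDiffOn_const, contDiffOn_const, fun _ _ =>
      congr_fun (fieldJ_eq_generalField i) _⟩
  · exact ⟨0, 0, 0, 0, κ, contDiffOn_const, hκ, fun _ _ =>
      congr_fun (fieldZ_eq_generalField κ) _⟩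

theorem generalField_mem_span (hχ : ContDiffOn ℝ ∞ χ (timeRange U))
    (hκ : ContDiffOn ℝ ∞ κ (timeRange U)) :
    generalField γ b c χ κ ∈ Submodule.span ℝ (spanningFields U) := by
  have hmem : ∀ {R : VField m}, R ∈ spanningFields U →
      R ∈ Submodule.span ℝ (spanningFields U) := fun hR => Submodule.subset_span hR
  rw [generalField_eq_sum]
  refine add_mem (add_mem (add_mem (add_mem ?_ ?_) ?_) (sum_mem fun i _ => ?_)) ?_
  · exact Submodule.smul_mem _ _ (hmem (.inl (.inl (.inl (.inl rfl)))))
  · exact Submodule.smul_mem _ _ (hmem (.inl (.inl (.inl (.inr rfl)))))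
  · exact hmem (.inl (.inl (.inr ⟨χ, hχ, rfl⟩)))
  · exact Submodule.smul_mem _ _ (hmem (.inl (.inr ⟨i, rfl⟩)))
  · exact hmem (.inr ⟨κ, hκ, rfl⟩)

namespace IsGeneralElementOn

theorem zero : IsGeneralElementOn U (0 : VField m) :=
  ⟨0, 0, 0, 0, 0, contDiffOn_const, contDiffOn_const, fun p _ => by
    ext k
    · fin_cases k <;> simp [generalField]
    · simp [generalField, Pi.zero_def]⟩

theorem add (hU : IsOpen U) (h₁ : IsGeneralElementOn U Q₁) (h₂ : IsGeneralElementOn U Q₂) :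
    IsGeneralElementOn U (Q₁ + Q₂) := by
  obtain ⟨γ₁, b₁, c₁, χ₁, κ₁, hχ₁, hκ₁, hQ₁⟩ := h₁
  obtain ⟨γ₂, b₂, c₂, χ₂, κ₂, hχ₂, hκ₂, hQ₂⟩ := h₂
  refine ⟨γ₁ + γ₂, b₁ + b₂, c₁ + c₂, χ₁ + χ₂, κ₁ + κ₂, hχ₁.add hχ₂, hκ₁.add hκ₂,
    fun p hp => ?_⟩
  have hderiv : deriv (χ₁ + χ₂) (p.1 0) = deriv χ₁ (p.1 0) + deriv χ₂ (p.1 0) :=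
    ((hasDerivAt_timeRange hU hχ₁ hp).add (hasDerivAt_timeRange hU hχ₂ hp)).deriv
  rw [Pi.add_apply, hQ₁ hp, hQ₂ hp]
  ext k
  · fin_cases k <;> simp [generalField]
  · simp only [generalField, hderiv, Prod.snd_add, Pi.add_apply]
    ring

theorem smul (hU : IsOpen U) (r : ℝ) (h : IsGeneralElementOn U Q) :
    IsGeneralElementOn U (r • Q) := by
  obtain ⟨γ, b, c, χ, κ, hχ, hκ, hQ⟩ := h
  refine ⟨r * γ, r * b, r • c, r • χ, r • κ, contDiffOn_const.smul hχ, contDiffOn_const.smul hκ,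
    fun p hp => ?_⟩
  have hderiv : deriv (r • χ) (p.1 0) = r * deriv χ (p.1 0) :=
    ((hasDerivAt_timeRange hU hχ hp).const_smul r).deriv
  rw [Pi.smul_apply, hQ hp]
  ext k
  · fin_cases k <;> simp [generalField]
  · simp only [generalField, hderiv, Prod.smul_snd, Pi.smul_apply, smul_eq_mul]
    ring

theorem of_mem_span (hU : IsOpen U) (hQ : Q ∈ Submodule.span ℝ (spanningFields U)) :
    IsGeneralElementOn U Q := by
  induction hQ using Submodule.span_induction with
  | mem R hR => exact isGeneralElementOn_of_mem_spanningFields hR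
  | zero => exact zero
  | add R S _ _ hR hS => exact hR.add hU hS
  | smul r R _ hR => exact hR.smul hU r

theorem iff_exists_mem_span (hU : IsOpen U) : IsGeneralElementOn U Q ↔
    ∃ G ∈ Submodule.span ℝ (spanningFields U), Set.EqOn Q G U := by
  constructor
  · rintro ⟨γ, b, c, χ, κ, hχ, hκ, hQ⟩
    exact ⟨_, generalField_mem_span hχ hκ, hQ⟩
  · rintro ⟨G, hG, hQG⟩
    obtain ⟨γ, b, c, χ, κ, hχ, hκ, hG⟩ := of_mem_span hU hG
    exact ⟨γ, b, c, χ, κ, hχ, hκ, hQG.trans hG⟩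

theorem lieBracket (hU : IsOpen U) (h₁ : IsGeneralElementOn U Q₁)
    (h₂ : IsGeneralElementOn U Q₂) :
    IsGeneralElementOn U (VectorField.lieBracket ℝ Q₁ Q₂) := by
  obtain ⟨γ₁, b₁, c₁, χ₁, κ₁, hχ₁, hκ₁, hQ₁⟩ := h₁
  obtain ⟨γ₂, b₂, c₂, χ₂, κ₂, hχ₂, hκ₂, hQ₂⟩ := h₂
  have hsmooth := fun {χ : ℝ → ℝ} => contDiffOn_deriv_timeRange (χ := χ) hU
  refine ⟨0, 0, 0, γ₁ • deriv χ₂ - γ₂ • deriv χ₁,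
    γ₁ • deriv κ₂ - γ₂ • deriv κ₁ - (b₁ • deriv χ₂ - b₂ • deriv χ₁),
    (contDiffOn_const.smul (hsmooth hχ₂)).sub (contDiffOn_const.smul (hsmooth hχ₁)),
    ((contDiffOn_const.smul (hsmooth hκ₂)).sub (contDiffOn_const.smul (hsmooth hκ₁))).sub
      ((contDiffOn_const.smul (hsmooth hχ₂)).sub (contDiffOn_const.smul (hsmooth hχ₁))),
    fun p hp => ?_⟩
  have hderiv : deriv (γ₁ • deriv χ₂ - γ₂ • deriv χ₁) (p.1 0)
      = γ₁ * deriv (deriv χ₂) (p.1 0) - γ₂ * deriv (deriv χ₁) (p.1 0) :=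
    (((hasDerivAt_timeRange hU (hsmooth hχ₂) hp).const_smul γ₁).sub
      ((hasDerivAt_timeRange hU (hsmooth hχ₁) hp).const_smul γ₂)).deriv
  have hbracket : VectorField.lieBracket ℝ Q₁ Q₂ p
      = dirDeriv (Q₁ p) Q₂ p - dirDeriv (Q₂ p) Q₁ p := rfl
  rw [hbracket, eqOn_dirDeriv hU hQ₂ _ hp, eqOn_dirDeriv hU hQ₁ _ hp, hQ₁ hp, hQ₂ hp,
    dirDeriv_generalField hU hχ₁ hκ₁ _ hp, dirDeriv_generalField hU hχ₂ hκ₂ _ hp]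
  ext k
  · fin_cases k <;> simp [generalField]
  · simp only [generalField, Matrix.cons_val_zero, Matrix.cons_val, Prod.mk_sub_mk, Pi.sub_apply,
      Pi.smul_apply, smul_eq_mul, Pi.zero_apply, hderiv]
    ring

end IsGeneralElementOn

end Span

end

end MultiLayerQG

open MultiLayerQG in
theorem mainTheorem1 (m : ℕ) (hm : 2 ≤ m) (f : Fin m → Fin m → ℝ) (β : ℝ)
    (hf : ∀ i j : Fin m, i.val + 1 = j.val → 0 < f i j * f j i) (hβ : β ≠ 0)
    (U : Set (PointSpace m)) (hU : IsOpen U) (hUc : Convex ℝ U) :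
    maxLieInvarianceAlgebra f β U
        = {Q | ∃ G ∈ Submodule.span ℝ (spanningFields U), Set.EqOn Q G U} ∧
      ∀ Q₁ ∈ maxLieInvarianceAlgebra f β U, ∀ Q₂ ∈ maxLieInvarianceAlgebra f β U,
        VectorField.lieBracket ℝ Q₁ Q₂ ∈ maxLieInvarianceAlgebra f β U := by
  have h : ∀ Q : VField m, IsLieSymmetryOn f β U Q ↔ IsGeneralElementOn U Q := fun Q =>
    ⟨fun hQ => (hQ.solvesDeterminingEquations hm hU hf hβ).isGeneralElementOn hU hUc (by omega),
      fun hQ => (hQ.solvesDeterminingEquations hU).isLieSymmetryOn hU⟩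
  refine ⟨Set.ext fun Q => (h Q).trans (IsGeneralElementOn.iff_exists_mem_span hU), ?_⟩
  intro Q₁ h₁ Q₂ h₂
  exact (h _).2 (((h _).1 h₁).lieBracket hU ((h _).1 h₂))
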